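/- Let $\Lambda_{\mathbb Q}$ be the algebra of symmetric functions over $\mathbb Q$ in the variables $x=(x_1,x_2,\dots)$, with elementary, complete homogeneous and power sum symmetric functions $e_k,h_k,p_k$, and let $\omega$ be the algebra involution of $\Lambda_{\mathbb Q}$ with $\omega(e_k)=h_k$ for all $k\ge 1$. For $f\in\Lambda_{\mathbb Q}$ let $f(x/y)=\omega_y f(x,y)$, where $f(x,y)$ is $f$ in the union of the alphabets $x$ and $y=(y_1,y_2,\dots)$ and $\omega_y$ is $\omega$ acting on the $y$ variables only, and let $f(x/x)$ be the result of putting $y=x$ in $f(x/y)$. For $n\ge 1$ let $P_n$ be Schur's $P$-function indexed by the one-row partition $(n)$, that is, $2P_n=\sum_{k=0}^n e_kh_{n-k}$, and for a partition $\lambda$ let $V_\lambda=P_{\lambda_1}P_{\lambda_2}\cdots$ (product over the parts of $\lambda$). A parking function of length $n$ is a sequence $(a_1,\dots,a_n)$ of positive integers whose increasing rearrangement $b_1\le\cdots\le b_n$ satisfies $b_i\le i$ for all $i$; let $\mathrm{PF}_n$ be the Frobenius characteristic of the action of the symmetric group $\mathfrak S_n$ on the parking functions of length $n$ by permuting coordinates,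 and let $\mathrm{sh}_n=\mathrm{PF}_n(x/x)$. The functions $P_1,P_3,P_5,\dots$ are algebraically independent over $\mathbb Q$, and for every $n\ge 0$ $$\mathrm{sh}_n=\sum_{\substack{\lambda\vdash n\\ \text{all }\lambda_i\text{ odd}}}\frac{2^{\ell}}{\ell!}\binom{\ell}{m_1,m_3,\dots}(n+\ell-1)(n+\ell-3)\cdots(n-\ell+3)\,V_\lambda ,$$ where $\ell=\ell(\lambda)$ is the number of parts of $\lambda$, $m_i$ is the number of parts of $\lambda$ equal to $i$, and the product $(n+\ell-1)(n+\ell-3)\cdots(n-\ell+3)=\prod_{j=0}^{\ell-2}(n+\ell-1-2j)$ has $\ell-1$ factors and is read as $1$ if $\ell\le 1$. All the coefficients in this sum are nonnegative. -/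

import Mathlib

/-! Symmetric functions are formal power series over `ℚ` in the variables `x₀, x₁, x₂, …`. -/

namespace ShiftedParking

open scoped Classical in
/-- The elementary symmetric function `e_k`: the sum of all squarefree monomials of degree `k`. -/
noncomputable def elemSym (k : ℕ) : MvPowerSeries ℕ ℚ :=
  fun d => if d.degree = k ∧ ∀ i, d i ≤ 1 then 1 else 0

open scoped Classical in
/-- The complete homogeneous symmetric function `h_k`: the sum of all monomials of degree `k`. -/
noncomputable def complSym (k : ℕ) : MvPowerSeries ℕ ℚ :=
  fun d => if d.degree = k then 1 else 0

open scoped Classical in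
/-- The power sum `p_k = ∑ i, x_i ^ k` (for `k ≥ 1`). -/
noncomputable def powerSum (k : ℕ) : MvPowerSeries ℕ ℚ :=
  fun d => if ∃ i, d = Finsupp.single i k then 1 else 0

/-- Setting all but the first `N` variables to zero in `e_k` gives the elementary symmetric
polynomial in `N` variables. -/
theorem killCompl_elemSym (N k : ℕ) :
    MvPowerSeries.killCompl (R := ℚ) (Fin.valEmbedding (n := N)) (elemSym k) =
      ((MvPolynomial.esymm (Fin N) ℚ k : MvPolynomial (Fin N) ℚ) : MvPowerSeries (Fin N) ℚ) := by
  classical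
  ext d
  have key : ∀ t : Finset (Fin N), (∑ i ∈ t, Finsupp.single i 1) = d ↔
      t = d.support ∧ ∀ i, d i ≤ 1 := by
    intro t
    have hv : ∀ j, (∑ i ∈ t, Finsupp.single i (1 : ℕ)) j = if j ∈ t then 1 else 0 := by
      intro j
      simp [Finsupp.finsetSum_apply, Finsupp.single_apply]
    constructor
    · rintro rfl
      refine ⟨?_, ?_⟩
      · ext j
        rw [Finsupp.mem_support_iff, hv]
        simp
      · intro j
        rw [hv]
        split_ifs <;> simp
    · rintro ⟨rfl, h⟩
      ext j
      rw [hv]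
      have := h j
      by_cases hj : d j = 0
      · simp [hj]
      · simp [hj]
        omega
  have hdeg : (Finsupp.embDomain Fin.valEmbedding d).degree = d.degree := by
    rw [Finsupp.degree_apply, Finsupp.degree_apply, Finsupp.support_embDomain, Finset.sum_map]
    exact Finset.sum_congr rfl fun i _ => Finsupp.embDomain_apply_self _ _ _
  have hle : (∀ i, (Finsupp.embDomain (Fin.valEmbedding (n := N)) d) i ≤ 1) ↔ ∀ i, d i ≤ 1 := by
    constructor
    · intro h i
      have := h (Fin.valEmbedding i)
      rwa [Finsupp.embDomain_apply_self] at this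
    · intro h i
      by_cases hi : i ∈ Set.range (Fin.valEmbedding (n := N))
      · obtain ⟨j, rfl⟩ := hi
        rw [Finsupp.embDomain_apply_self]
        exact h j
      · rw [Finsupp.embDomain_of_notMem_range _ _ _ hi]
        exact Nat.zero_le _
  rw [MvPowerSeries.coeff_killCompl, MvPolynomial.coeff_coe, MvPolynomial.esymm_eq_sum_monomial,
    MvPolynomial.coeff_sum]
  simp only [MvPolynomial.coeff_monomial, key]
  change (if _ ∧ _ then (1 : ℚ) else 0) = _
  rw [hdeg, hle]
  by_cases h1 : ∀ i, d i ≤ 1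
  · have hcard : d.degree = d.support.card := by
      rw [Finsupp.degree_apply, Finset.card_eq_sum_ones]
      refine Finset.sum_congr rfl fun i hi => ?_
      have := h1 i
      have := Finsupp.mem_support_iff.1 hi
      omega
    simp only [h1, implies_true, and_true, Finset.sum_ite_eq', Finset.mem_powersetCard_univ,
      hcard]
  · simp [h1]

/-- The functions `e_1, e_2, e_3, …` are algebraically independent. -/
theorem elemSym_algebraicIndependent :
    AlgebraicIndependent ℚ (fun i : ℕ => elemSym (i + 1)) := by
  rw [algebraicIndependent_iff]
  intro p hp
  obtain ⟨N, hN⟩ : ∃ N, ∀ i ∈ p.vars, i < N :=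
    ⟨p.vars.sup id + 1, fun i hi => Nat.lt_succ_of_le (Finset.le_sup (f := id) hi)⟩
  obtain ⟨q, rfl⟩ := MvPolynomial.exists_rename_eq_of_vars_subset_range p
    (Fin.val : Fin N → ℕ) Fin.val_injective (fun i hi => ⟨⟨i, hN i hi⟩, rfl⟩)
  have h := congrArg (MvPowerSeries.killCompl (R := ℚ) (Fin.valEmbedding (n := N))) hp
  rw [MvPolynomial.aeval_rename, map_zero, ← AlgHom.comp_apply, MvPolynomial.comp_aeval] at h
  have h2 : MvPolynomial.aeval (fun i : Fin N => MvPolynomial.esymm (Fin N) ℚ (i + 1)) q = 0 := by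
    apply MvPolynomial.coe_injective (Fin N) ℚ
    have h3 := MvPolynomial.comp_aeval (R := ℚ)
      (fun i : Fin N => MvPolynomial.esymm (Fin N) ℚ (i + 1))
      (MvPolynomial.coeToMvPowerSeries.algHom (σ := Fin N) (R := ℚ) ℚ)
    have h4 := DFunLike.congr_fun h3 q
    simp only [AlgHom.comp_apply, MvPolynomial.coeToMvPowerSeries.algHom_apply] at h4
    simp only [Function.comp_def, killCompl_elemSym] at h
    exact (h4.trans h).trans MvPolynomial.coe_zero.symm
  have hinj := MvPolynomial.esymmAlgHom_fin_injective (R := ℚ) (le_refl N)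
  have hq : q = 0 := by
    apply hinj
    apply Subtype.ext
    rw [MvPolynomial.esymmAlgHom_apply, h2, map_zero]
    rfl
  rw [hq, map_zero]

/-- The algebra `Λ_ℚ = ℚ[e_1, e_2, e_3, …]` of symmetric functions over `ℚ`. -/
noncomputable abbrev symFun : Subalgebra ℚ (MvPowerSeries ℕ ℚ) :=
  Algebra.adjoin ℚ (Set.range fun i : ℕ => elemSym (i + 1))

/-- The involution `ω`: the algebra homomorphism on `Λ_ℚ` with `ω e_k = h_k` for all `k ≥ 1`. -/
noncomputable def omega : symFun →ₐ[ℚ] MvPowerSeries ℕ ℚ :=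
  (MvPolynomial.aeval fun i : ℕ => complSym (i + 1)).comp
    elemSym_algebraicIndependent.aevalEquiv.symm.toAlgHom

theorem omega_elemSym (i : ℕ) :
    omega ⟨elemSym (i + 1), Algebra.subset_adjoin ⟨i, rfl⟩⟩ = complSym (i + 1) := by
  have h : (⟨elemSym (i + 1), Algebra.subset_adjoin ⟨i, rfl⟩⟩ :
      Algebra.adjoin ℚ (Set.range fun i : ℕ => elemSym (i + 1))) =
      elemSym_algebraicIndependent.aevalEquiv (MvPolynomial.X i) := by
    apply Subtype.ext
    simp
  change MvPolynomial.aeval _ (elemSym_algebraicIndependent.aevalEquiv.symm _) = _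
  rw [h, AlgEquiv.symm_apply_apply, MvPolynomial.aeval_X]

/-- `f(x, y)`: the symmetric function `f` in the union of the alphabets `x` (the left summand)
and `y` (the right summand). For symmetric `f` the bijection `ℕ ⊕ ℕ ≃ ℕ` is immaterial. -/
noncomputable def twoAlphabets (f : MvPowerSeries ℕ ℚ) : MvPowerSeries (ℕ ⊕ ℕ) ℚ :=
  MvPowerSeries.rename Equiv.natSumNatEquivNat.symm f

/-- The coefficient of the monomial `x ^ a` in `F(x, y)`, a power series in `y`. -/
noncomputable def coeffX (a : ℕ →₀ ℕ) (F : MvPowerSeries (ℕ ⊕ ℕ) ℚ) : MvPowerSeries ℕ ℚ :=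
  fun b => MvPowerSeries.coeff (Finsupp.sumElim a b) F

open scoped Classical in
/-- `ω_y F`: the involution `ω` acting on the `y` variables only, that is, on the coefficient
of each monomial in the `x` variables (coefficients outside `Λ_ℚ` are sent to `0`). -/
noncomputable def omegaY (F : MvPowerSeries (ℕ ⊕ ℕ) ℚ) : MvPowerSeries (ℕ ⊕ ℕ) ℚ :=
  fun d =>
    let a : ℕ →₀ ℕ := (Finsupp.sumFinsuppEquivProdFinsupp d).1
    let b : ℕ →₀ ℕ := (Finsupp.sumFinsuppEquivProdFinsupp d).2
    if h : coeffX a F ∈ symFun then MvPowerSeries.coeff b (omega ⟨coeffX a F, h⟩) else 0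

/-- The superfication `f(x/y) = ω_y f(x, y)`. -/
noncomputable def superfication (f : MvPowerSeries ℕ ℚ) : MvPowerSeries (ℕ ⊕ ℕ) ℚ :=
  omegaY (twoAlphabets f)

instance tendstoCofinite_fold :
    Filter.TendstoCofinite (Sum.elim id id : ℕ ⊕ ℕ → ℕ) := by
  rw [Filter.tendstoCofinite_iff_finite_preimage_singleton]
  intro b
  refine Set.Finite.subset (Set.toFinite {Sum.inl b, Sum.inr b}) ?_
  rintro (x | x) hx <;> simp_all

/-- The shiftification `f(x/x)`: put `y = x` in `f(x/y)`. -/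
noncomputable def shiftification (f : MvPowerSeries ℕ ℚ) : MvPowerSeries ℕ ℚ :=
  MvPowerSeries.rename (Sum.elim id id : ℕ ⊕ ℕ → ℕ) (superfication f)

/-- Parking functions of length `n`: sequences of positive integers whose increasing
rearrangement `b_1 ≤ ⋯ ≤ b_n` satisfies `b_i ≤ i`. -/
def IsParking {n : ℕ} (a : Fin n → ℕ) : Prop :=
  (∀ i, 0 < a i) ∧ ∀ i : Fin n, (a ∘ Tuple.sort a) i ≤ (i : ℕ) + 1

/-- The set of parking functions of length `n`. -/
def Parking (n : ℕ) : Type := {a : Fin n → ℕ // IsParking a}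

theorem IsParking.comp_perm {n : ℕ} {a : Fin n → ℕ} (h : IsParking a)
    (w : Equiv.Perm (Fin n)) : IsParking (a ∘ w) := by
  refine ⟨fun i => h.1 (w i), fun i => ?_⟩
  rw [Tuple.comp_perm_comp_sort_eq_comp_sort]
  exact h.2 i

/-- The symmetric group acts on parking functions by permuting coordinates. -/
instance parkingAction (n : ℕ) : MulAction (Equiv.Perm (Fin n)) (Parking n) where
  smul w a := ⟨a.1 ∘ (w⁻¹ : Equiv.Perm (Fin n)), a.2.comp_perm w⁻¹⟩
  one_smul _ := rfl
  mul_smul w v a := Subtype.ext (by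
    change a.1 ∘ ((w * v)⁻¹ : Equiv.Perm (Fin n)) =
      (a.1 ∘ (v⁻¹ : Equiv.Perm (Fin n))) ∘ (w⁻¹ : Equiv.Perm (Fin n))
    rw [mul_inv_rev]
    rfl)

/-- The Frobenius characteristic of a class function `χ` on the symmetric group:
`(1 / n!) ∑ w, χ(w) p_{ρ(w)}`, where `ρ(w)` is the cycle type of `w`, fixed points included. -/
noncomputable def frobeniusChar {n : ℕ} (χ : Equiv.Perm (Fin n) → ℚ) : MvPowerSeries ℕ ℚ :=
  ((n.factorial : ℚ)⁻¹) • ∑ w : Equiv.Perm (Fin n), χ w • (w.partition.parts.map powerSum).prod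

/-- The parking function symmetric function `PF_n`: the Frobenius characteristic of the
permutation character of the symmetric group on parking functions of length `n`. -/
noncomputable def parkingSym (n : ℕ) : MvPowerSeries ℕ ℚ :=
  frobeniusChar fun w : Equiv.Perm (Fin n) => (Nat.card (MulAction.fixedBy (Parking n) w) : ℚ)

/-- The shifted parking function symmetric function `sh_n = PF_n(x/x)`. -/
noncomputable def shiftedParkingSym (n : ℕ) : MvPowerSeries ℕ ℚ :=
  shiftification (parkingSym n)

/-- Schur's `P`-function `P_n` indexed by the one-row partition `(n)`, for `n ≥ 1`:
`2 P_n = ∑_{k=0}^n e_k h_{n-k}`. -/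
noncomputable def schurP (n : ℕ) : MvPowerSeries ℕ ℚ :=
  (1 / 2 : ℚ) • ∑ k ∈ Finset.range (n + 1), elemSym k * complSym (n - k)

/-- `V_λ = P_{λ_1} P_{λ_2} ⋯`. -/
noncomputable def prodP {n : ℕ} (lam : n.Partition) : MvPowerSeries ℕ ℚ :=
  (lam.parts.map schurP).prod

/-- The number `(2^ℓ / ℓ!) * binom(ℓ; m_1, m_3, …) * (n+ℓ-1)(n+ℓ-3)⋯(n-ℓ+3)`, where `ℓ` is the
length of `λ` and `m_i` the number of its parts equal to `i`; the last product has `ℓ - 1`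
factors (none if `ℓ ≤ 1`). -/
def shiftedCoeff {n : ℕ} (lam : n.Partition) : ℚ :=
  (2 : ℚ) ^ lam.parts.card / (lam.parts.card.factorial : ℚ)
    * (Nat.multinomial lam.parts.toFinset (fun i => lam.parts.count i) : ℚ)
    * ∏ j ∈ Finset.range (lam.parts.card - 1),
        ((n : ℚ) + (lam.parts.card : ℚ) - 1 - 2 * (j : ℚ))

end ShiftedParking

/-!
Pollak's cycle lemma shows that a permutation with `c` cycles fixes `(n + 1) ^ (c - 1)` parking
functions. Hence `PF_n` is `1 / (n + 1)` times the Frobenius characteristic of the action on all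
words in `n + 1` letters, that is, `PF_n = [t ^ n] H(t) ^ (n + 1) / (n + 1)`. Shiftification is
the algebra homomorphism that sends `E(t)` and `H(t)` to `Q(t) = E(t) H(t) = 1 + 2 ∑ P_n t ^ n`,
so `sh_n = [t ^ n] Q(t) ^ (n + 1) / (n + 1)`.

As `Q(t) Q(-t) = 1`, the series `Q` is determined by its odd part `U`: it is the root
`U + √(1 + U ^ 2) = exp (arcsinh U)` of `Q ^ 2 = 1 + 2 U Q`. The coefficients of powers of
`u + √(1 + u ^ 2)` are central factorials, and expanding the powers of `U = 2 ∑ P_{2i+1} t^{2i+1}`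
gives the formula. Conversely `E`, and with it the odd part of `Q`, can be prescribed at will,
which makes `P_1, P_3, …` algebraically independent.
-/

namespace ShiftedParking

section Parking

open Equiv MulAction

theorem isParking_succ_iff {n : ℕ} (b : Fin n → ℕ) :
    IsParking (fun i => b i + 1) ↔ ∀ k ≤ n, k ≤ (Finset.univ.filter fun i => b i < k).card := by
  have hsort : ∀ i : Fin n,
      ((fun j => b j + 1) ∘ Tuple.sort fun j => b j + 1) i ≤ (i : ℕ) + 1 ↔
        (i : ℕ) + 1 ≤ (Finset.univ.filter fun j => b j < i + 1).card := by
    intro i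
    rw [← Tuple.lt_card_le_iff_apply_le_of_monotone (Tuple.monotone_sort fun j => b j + 1),
      Nat.lt_iff_add_one_le,
      Finset.card_equiv (t := Finset.univ.filter fun j => b j < i + 1)
        (Tuple.sort fun j => b j + 1) fun j => by simp]
  simp only [IsParking, Nat.succ_pos, implies_true, true_and, hsort]
  refine ⟨fun h k hk => ?_, fun h i => h _ i.2⟩
  rcases k with _ | k
  · exact Nat.zero_le _
  · exact h ⟨k, hk⟩

theorem IsParking.le {n : ℕ} {a : Fin n → ℕ} (h : IsParking a) (i : Fin n) : a i ≤ n := by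
  have := h.2 ((Tuple.sort a).symm i)
  rw [Function.comp_apply, apply_symm_apply] at this
  exact this.trans ((Tuple.sort a).symm i).2

/-- A first minimum of `S` over a period is a starting point, and the drop rules out a second. -/
theorem existsUnique_cyclic_start {n : ℕ} {S : ℕ → ℤ} (hS : ∀ v, S (v + (n + 1)) = S v - 1) :
    ∃! s, s ≤ n ∧ ∀ k ≤ n, S s ≤ S (s + k) := by
  have huniq : ∀ s t, s < t → t ≤ n → (∀ k ≤ n, S s ≤ S (s + k)) →
      ¬ ∀ k ≤ n, S t ≤ S (t + k) := by
    intro s t hst htn hs ht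
    have h₁ := hs (t - s) (by omega)
    have h₂ := ht (s + (n + 1) - t) (by omega)
    rw [show s + (t - s) = t by omega] at h₁
    rw [show t + (s + (n + 1) - t) = s + (n + 1) by omega, hS] at h₂
    omega
  have hmin : ∃ s, s ≤ n ∧ ∀ v ≤ n, S s ≤ S v := by
    obtain ⟨s, hs, h⟩ := Finset.exists_min_image (Finset.range (n + 1)) S ⟨0, by simp⟩
    exact ⟨s, by simpa [Nat.lt_succ_iff] using hs, fun v hv => h v (by simpa [Nat.lt_succ_iff])⟩
  classical
  obtain ⟨hfn, hf⟩ := Nat.find_spec hmin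
  have hbefore : ∀ v < Nat.find hmin, S (Nat.find hmin) < S v := by
    intro v hv
    by_contra! h
    exact Nat.find_min hmin hv ⟨by omega, fun u hu => h.trans (hf u hu)⟩
  have hstart : ∀ k ≤ n, S (Nat.find hmin) ≤ S (Nat.find hmin + k) := by
    intro k hk
    rcases le_or_gt (Nat.find hmin + k) n with h | h
    · exact hf _ h
    · obtain ⟨v, hv⟩ := Nat.exists_eq_add_of_le (Nat.succ_le_of_lt h)
      rw [hv, add_comm, hS]
      have := hbefore v (by omega)
      omega
  refine ⟨Nat.find hmin, ⟨hfn, hstart⟩, fun t ⟨htn, ht⟩ => ?_⟩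
  rcases lt_trichotomy t (Nat.find hmin) with h | h | h
  · exact (huniq _ _ h hfn ht hstart).elim
  · exact h
  · exact (huniq _ _ h htn hstart ht).elim

theorem card_filter_val_sub_lt {ι : Type*} [Fintype ι] {N : ℕ} [NeZero N] (f : ι → ZMod N)
    (v : ℕ) {k : ℕ} (hk : k ≤ N) :
    (Finset.univ.filter fun i => (f i - v).val < k).card =
      ∑ u ∈ Finset.range k, (Finset.univ.filter fun i => f i = (v + u : ℕ)).card := by
  rw [Finset.card_eq_sum_card_fiberwise (f := fun i => (f i - v).val) (t := Finset.range k)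
    fun i hi => by simpa using hi]
  refine Finset.sum_congr rfl fun u hu => congrArg Finset.card (Finset.ext fun i => ?_)
  rw [Finset.mem_range] at hu
  have hval : (u : ZMod N).val = u := ZMod.val_cast_of_lt (hu.trans_le hk)
  have hiff : (f i - v).val = u ↔ f i = (v + u : ℕ) := by
    conv_lhs => rw [← hval, (ZMod.val_injective N).eq_iff, sub_eq_iff_eq_add', ← Nat.cast_add]
  simp only [Finset.mem_filter, Finset.mem_univ, true_and, hiff]
  exact ⟨fun h => h.2, fun h => ⟨by rw [hiff.2 h]; exact hu, h⟩⟩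

theorem existsUnique_isParking_sub {n : ℕ} (f : Fin n → ZMod (n + 1)) :
    ∃! c : ZMod (n + 1), IsParking fun i => (f i - c).val + 1 := by
  let S : ℕ → ℤ := fun v =>
    ∑ u ∈ Finset.range v, (((Finset.univ.filter fun i => f i = (u : ℕ)).card : ℤ) - 1)
  have hS : ∀ v k, k ≤ n + 1 →
      S (v + k) = S v + ((Finset.univ.filter fun i => (f i - v).val < k).card - k) := by
    intro v k hk
    rw [card_filter_val_sub_lt f v hk]
    simp only [S, Finset.sum_range_add, Finset.sum_sub_distrib, Finset.sum_const,
      Finset.card_range, nsmul_eq_mul, Nat.cast_sum, Nat.cast_add]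
    ring
  have hperiod : ∀ v, S (v + (n + 1)) = S v - 1 := by
    intro v
    rw [hS v _ le_rfl, Finset.filter_true_of_mem fun i _ => ZMod.val_lt _, Finset.card_univ,
      Fintype.card_fin]
    push_cast
    ring
  have hpark : ∀ s : ℕ, IsParking (fun i => (f i - s).val + 1) ↔ ∀ k ≤ n, S s ≤ S (s + k) := by
    intro s
    rw [isParking_succ_iff]
    refine forall₂_congr fun k hk => ?_
    rw [hS s k (by omega)]
    omega
  obtain ⟨s, ⟨-, hs⟩, huniq⟩ := existsUnique_cyclic_start hperiod
  refine ⟨s, (hpark s).2 hs, fun c hc => ?_⟩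
  rw [← ZMod.natCast_zmod_val c] at hc ⊢
  rw [huniq _ ⟨Nat.lt_succ_iff.1 (ZMod.val_lt c), (hpark _).1 hc⟩]

/-- The sequence in `ℤ/(n + 1)` obtained by translating the parking function `a` by `c`, with the
values `1, …, n` of a parking function read as the residues `0, …, n - 1`. -/
def translate {n : ℕ} (p : Parking n × ZMod (n + 1)) : Fin n → ZMod (n + 1) :=
  fun i => p.1.1 i - 1 + p.2

theorem val_translate_sub_add_one {n : ℕ} (p : Parking n × ZMod (n + 1)) (i : Fin n) :
    (translate p i - p.2).val + 1 = p.1.1 i := by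
  obtain ⟨⟨a, ha⟩, c⟩ := p
  obtain ⟨b, hb⟩ := Nat.exists_eq_add_of_le' (ha.1 i)
  have hbn : b < n + 1 := by have := ha.le i; omega
  simp [translate, hb, ZMod.val_cast_of_lt hbn]

theorem translate_bijective (n : ℕ) :
    Function.Bijective (translate : Parking n × ZMod (n + 1) → Fin n → ZMod (n + 1)) := by
  constructor
  · intro p q h
    have hpark : ∀ r : Parking n × ZMod (n + 1),
        IsParking fun i => (translate r i - r.2).val + 1 := fun r => by
      simpa only [val_translate_sub_add_one] using r.1.2
    have h₂ : p.2 = q.2 :=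
      (existsUnique_isParking_sub (translate p)).unique (hpark p) (by rw [h]; exact hpark q)
    refine Prod.ext (Subtype.ext (funext fun i => ?_)) h₂
    rw [← val_translate_sub_add_one, ← val_translate_sub_add_one, h, h₂]
  · intro f
    obtain ⟨c, hc, -⟩ := existsUnique_isParking_sub f
    exact ⟨(⟨_, hc⟩, c), funext fun i => by simp [translate]⟩

theorem mem_fixedBy_iff_translate_comp {n : ℕ} (w : Perm (Fin n))
    (p : Parking n × ZMod (n + 1)) :
    p.1 ∈ fixedBy (Parking n) w ↔ translate p ∘ w = translate p := by
  have hsmul : translate (w • p.1, p.2) = translate p ∘ w.symm := rfl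
  rw [mem_fixedBy, eq_comm (a := translate p ∘ w), ← comp_symm_eq, ← hsmul,
    (translate_bijective n).1.eq_iff, Prod.ext_iff]
  simp

theorem card_fixedBy_parking (n : ℕ) (w : Perm (Fin n)) :
    Nat.card (fixedBy (Parking n) w) * (n + 1) =
      Nat.card {f : Fin n → ZMod (n + 1) // f ∘ w = f} := by
  conv_lhs => rw [← Nat.card_zmod (n + 1), ← Nat.card_prod]
  exact Nat.card_congr <|
    (Equiv.prodSubtypeFstEquivSubtypeProd (p := (· ∈ fixedBy (Parking n) w))).symm.trans <|
      (Equiv.ofBijective _ (translate_bijective n)).subtypeEquiv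
        (mem_fixedBy_iff_translate_comp w)

end Parking

section Words

open Equiv MulAction

variable {ι σ : Type*} [Fintype ι]

/-- The content of a word `g`: the number of occurrences of each letter, which is the exponent of
the monomial `∏ i, x_{g i}`. -/
noncomputable def content (g : ι → σ) : σ →₀ ℕ := ∑ i, Finsupp.single (g i) 1

theorem content_apply (g : ι → σ) (c : σ) : content g c = Nat.card {i // g i = c} := by
  classical
  simp [content, Finsupp.finsetSum_apply, Finsupp.single_apply, Fintype.card_subtype]

theorem content_comp_perm (g : ι → σ) (w : Perm ι) : content (g ∘ w) = content g :=
  Equiv.sum_comp w fun i => Finsupp.single (g i) 1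

theorem degree_content (g : ι → σ) : (content g).degree = Fintype.card ι := by
  simp [content, map_sum]

theorem mapDomain_content {τ : Type*} (φ : σ → τ) (g : ι → σ) :
    (content g).mapDomain φ = content (φ ∘ g) := by
  simp [content, Finsupp.mapDomain_finsetSum]

theorem exists_perm_of_content_eq {f g : ι → σ} (h : content f = content g) :
    ∃ w : Perm ι, g ∘ w = f := by
  have hcard : ∀ c, Nat.card {i // f i = c} = Nat.card {i // g i = c} := fun c => by
    rw [← content_apply, ← content_apply, h]
  exact ⟨ofFiberEquiv fun c => (Finite.card_eq.1 (hcard c)).some,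
    funext fun i => ofFiberEquiv_map _ i⟩

theorem exists_content_eq {E : σ →₀ ℕ} (hE : E.degree = Fintype.card ι) :
    ∃ g : ι → σ, content g = E := by
  classical
  have hcard : Fintype.card ι = Fintype.card E.toMultiset := by
    rw [Multiset.card_coe, Finsupp.card_toMultiset, ← hE, Finsupp.degree_apply]
    rfl
  refine ⟨fun i => (Fintype.equivOfCardEq hcard i).1, ?_⟩
  calc content (fun i => (Fintype.equivOfCardEq hcard i).1)
      = ∑ x : E.toMultiset, Finsupp.single x.1 1 :=
        (Fintype.equivOfCardEq hcard).sum_comp fun x => Finsupp.single x.1 1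
    _ = (E.toMultiset.map fun a => Finsupp.single a 1).sum :=
        congrArg Multiset.sum (Multiset.map_univ E.toMultiset fun a => Finsupp.single a 1)
    _ = E := by
        conv_rhs => rw [← Finsupp.toMultiset_toFinsupp E,
          ← Multiset.sum_map_singleton E.toMultiset, map_multiset_sum, Multiset.map_map]
        simp

/-- The symmetric group permutes the places of the words of given content. -/
instance wordAction (E : σ →₀ ℕ) : MulAction (Perm ι) {g : ι → σ // content g = E} where
  smul w g := ⟨g.1 ∘ w.symm, (content_comp_perm g.1 w.symm).trans g.2⟩
  one_smul _ := rfl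
  mul_smul _ _ _ := rfl

instance wordAction_isPretransitive (E : σ →₀ ℕ) :
    IsPretransitive (Perm ι) {g : ι → σ // content g = E} where
  exists_smul_eq f g := by
    obtain ⟨w, hw⟩ := exists_perm_of_content_eq (g.2.trans f.2.symm)
    exact ⟨w.symm, Subtype.ext hw⟩

theorem mem_fixedBy_word_iff {E : σ →₀ ℕ} (w : Perm ι) (g : {g : ι → σ // content g = E}) :
    g ∈ fixedBy _ w ↔ g.1 ∘ w = g.1 := by
  have hsmul : (w • g).1 = g.1 ∘ w.symm := rfl
  rw [mem_fixedBy, Subtype.ext_iff, hsmul, comp_symm_eq, eq_comm]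

instance finite_word (E : σ →₀ ℕ) : Finite {g : ι → σ // content g = E} := by
  classical
  rcases isEmpty_or_nonempty {g : ι → σ // content g = E} with h | ⟨⟨g⟩⟩
  · infer_instance
  · exact Finite.of_surjective (fun w : Perm ι => w • g) fun f => exists_smul_eq _ g f

/-- Burnside's lemma for the transitive action of the symmetric group on the words of given
content. -/
theorem sum_card_invariant_word [DecidableEq ι] {E : σ →₀ ℕ} (hE : E.degree = Fintype.card ι) :
    ∑ w : Perm ι, Nat.card {g : ι → σ // content g = E ∧ g ∘ w = g} =
      (Fintype.card ι).factorial := by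
  obtain ⟨g, hg⟩ := exists_content_eq hE
  have : Nonempty {g : ι → σ // content g = E} := ⟨⟨g, hg⟩⟩
  have hcard : ∀ w : Perm ι, Nat.card {g : ι → σ // content g = E ∧ g ∘ w = g} =
      Nat.card (fixedBy {g : ι → σ // content g = E} w) := fun w => Nat.card_congr <|
    (subtypeSubtypeEquivSubtypeInter _ _).symm.trans <|
      subtypeEquivRight fun g => (mem_fixedBy_word_iff w g).symm
  have : Nonempty (Quotient (orbitRel (Perm ι) {g : ι → σ // content g = E})) :=
    ⟨Quotient.mk _ ⟨g, hg⟩⟩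
  have := (pretransitive_iff_subsingleton_quotient (Perm ι)
    {g : ι → σ // content g = E}).1 inferInstance
  simp_rw [hcard]
  rw [← Nat.card_sigma, Nat.card_congr (sigmaFixedByEquivOrbitsProdGroup _ _), Nat.card_prod,
    Nat.card_of_subsingleton (Classical.arbitrary _), one_mul, Nat.card_perm,
    Nat.card_eq_fintype_card]

end Words

section Cycles

open Equiv Equiv.Perm

theorem apply_eq_of_sameCycle {ι σ : Type*} [Finite ι] {w : Perm ι} {g : ι → σ}
    (hg : g ∘ w = g) {x y : ι} (h : w.SameCycle x y) : g x = g y := by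
  obtain ⟨k, rfl⟩ := h.exists_nat_pow_eq
  rw [← iterate_eq_pow]
  exact (congrFun (Function.iterate_invariant hg k) x).symm

variable {ι : Type*} [Fintype ι] [DecidableEq ι]

/-- The cycles of `w`, cycles of length one being recorded as fixed points. -/
abbrev Cycles (w : Perm ι) : Type _ := w.cycleFactorsFinset ⊕ Function.fixedPoints w

/-- The cycle through a point. -/
def cycleThrough (w : Perm ι) (x : ι) : Cycles w :=
  if h : w x = x then .inr ⟨x, h⟩
  else .inl ⟨w.cycleOf x, cycleOf_mem_cycleFactorsFinset_iff.2 (mem_support.2 h)⟩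

/-- The length of a cycle. -/
def cycleLength {w : Perm ι} : Cycles w → ℕ := Sum.elim (fun c => c.1.support.card) fun _ => 1

theorem cycleThrough_eq_inl_iff {w : Perm ι} {x : ι} {c : w.cycleFactorsFinset} :
    cycleThrough w x = .inl c ↔ x ∈ c.1.support := by
  by_cases hx : w x = x
  · have hxc : x ∉ c.1.support := fun h =>
      mem_support.1 (mem_cycleFactorsFinset_support_le c.2 h) hx
    simp [cycleThrough, hx, hxc]
  · simp only [cycleThrough, hx, ↓reduceDIte, Sum.inl.injEq, Subtype.ext_iff]
    refine ⟨fun h => ?_, fun h => (cycle_is_cycleOf h c.2).symm⟩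
    rw [← h, mem_support_cycleOf_iff]
    exact ⟨SameCycle.refl _ _, mem_support.2 hx⟩

theorem cycleThrough_eq_inr_iff {w : Perm ι} {x : ι} {y : Function.fixedPoints w} :
    cycleThrough w x = .inr y ↔ x = y := by
  by_cases hx : w x = x
  · simp [cycleThrough, hx, Subtype.ext_iff]
  · have hxy : x ≠ y := fun h => hx (h ▸ y.2)
    simp [cycleThrough, hx, hxy]

theorem card_cycleThrough_fiber {w : Perm ι} (q : Cycles w) :
    (Finset.univ.filter fun x => cycleThrough w x = q).card = cycleLength q := by
  rcases q with c | y
  · simp only [cycleThrough_eq_inl_iff, Finset.filter_univ_mem, cycleLength, Sum.elim_inl]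
  · exact Finset.card_eq_one.2 ⟨y, by ext; simp [cycleThrough_eq_inr_iff]⟩

theorem cycleLength_ne_zero {w : Perm ι} (q : Cycles w) : cycleLength q ≠ 0 := by
  rcases q with c | _
  · have := (mem_cycleFactorsFinset_iff.1 c.2).1.two_le_card_support
    simp only [cycleLength, Sum.elim_inl]
    omega
  · exact one_ne_zero

theorem cycleThrough_surjective (w : Perm ι) : Function.Surjective (cycleThrough w) := by
  intro q
  obtain ⟨x, hx⟩ := Finset.card_ne_zero.1 ((card_cycleThrough_fiber q).trans_ne
    (cycleLength_ne_zero q))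
  exact ⟨x, (Finset.mem_filter.1 hx).2⟩

theorem cycleThrough_eq_iff {w : Perm ι} {x y : ι} :
    cycleThrough w x = cycleThrough w y ↔ w.SameCycle x y := by
  by_cases hx : w x = x <;> by_cases hy : w y = y
  · simp only [cycleThrough, hx, hy, ↓reduceDIte, Sum.inr.injEq, Subtype.ext_iff]
    exact ⟨fun h => h ▸ SameCycle.refl w x, fun h => h.eq_of_left hx⟩
  · simp only [cycleThrough, hx, hy, ↓reduceDIte, reduceCtorEq, false_iff]
    exact fun h => hy (h.apply_eq_self_iff.1 hx)
  · simp only [cycleThrough, hx, hy, ↓reduceDIte, reduceCtorEq, false_iff]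
    exact fun h => hx (h.apply_eq_self_iff.2 hy)
  · simp only [cycleThrough, hx, hy, ↓reduceDIte, Sum.inl.injEq, Subtype.mk.injEq]
    rw [sameCycle_iff_cycleOf_eq_of_mem_support (mem_support.2 hx) (mem_support.2 hy)]

theorem prod_map_parts_partition {M : Type*} [CommMonoid M] (w : Perm ι) (f : ℕ → M) :
    (w.partition.parts.map f).prod = ∏ q : Cycles w, f (cycleLength q) := by
  rw [Fintype.prod_sum_type, parts_partition, Multiset.map_add, Multiset.prod_add]
  congr 1
  · rw [cycleType_def, Multiset.map_map]
    exact (Finset.prod_coe_sort w.cycleFactorsFinset fun c => f c.support.card).symm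
  · rw [Multiset.map_replicate, Multiset.prod_replicate, ← sum_cycleType, ← card_fixedPoints]
    exact (Finset.prod_const (f 1)).symm

/-- The words invariant under `w` are the colourings of the cycles of `w`. -/
noncomputable def invariantEquiv (w : Perm ι) (σ : Type*) :
    {g : ι → σ // g ∘ w = g} ≃ (Cycles w → σ) where
  toFun g q := g.1 (cycleThrough_surjective w q).choose
  invFun h := ⟨h ∘ cycleThrough w, funext fun x =>
    congrArg h (cycleThrough_eq_iff.2 (sameCycle_apply_left.2 (SameCycle.refl w x)))⟩
  left_inv g := Subtype.ext <| funext fun x => apply_eq_of_sameCycle g.2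
    (cycleThrough_eq_iff.1 (cycleThrough_surjective w (cycleThrough w x)).choose_spec)
  right_inv h := funext fun q => congrArg h (cycleThrough_surjective w q).choose_spec

theorem content_comp_cycleThrough {σ : Type*} {w : Perm ι} (h : Cycles w → σ) :
    content (h ∘ cycleThrough w) = ∑ q, Finsupp.single (h q) (cycleLength q) := by
  simp only [content, Function.comp_apply]
  rw [← Finset.sum_fiberwise' Finset.univ (cycleThrough w) fun q => Finsupp.single (h q) 1]
  refine Finset.sum_congr rfl fun q _ => ?_
  rw [Finset.sum_const, card_cycleThrough_fiber, Finsupp.smul_single, smul_eq_mul, mul_one]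

end Cycles

section PowerSum

theorem coeff_prod_powerSum {κ : Type*} [Fintype κ] {c : κ → ℕ} (hc : ∀ q, c q ≠ 0)
    (d : ℕ →₀ ℕ) :
    MvPowerSeries.coeff d (∏ q, powerSum (c q)) =
      Nat.card {g : κ → ℕ // ∑ q, Finsupp.single (g q) (c q) = d} := by
  classical
  rw [MvPowerSeries.coeff_prod]
  have hcoeff : ∀ (k : ℕ) (e : ℕ →₀ ℕ), MvPowerSeries.coeff e (powerSum k) =
      if ∃ i, e = Finsupp.single i k then 1 else 0 := fun _ _ => rfl
  simp only [hcoeff, Fintype.prod_boole]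
  rw [Finset.sum_boole, ← Fintype.card_coe, ← Nat.card_eq_fintype_card]
  let φ : {g : κ → ℕ // ∑ q, Finsupp.single (g q) (c q) = d} →
      {l // l ∈ (Finset.univ.finsuppAntidiag d).filter fun l : κ →₀ ℕ →₀ ℕ =>
        ∀ q, ∃ i, l q = Finsupp.single i (c q)} := fun g =>
    ⟨Finsupp.equivFunOnFinite.symm fun q => Finsupp.single (g.1 q) (c q), by
      have hg := g.2
      simp [hg, Finsupp.single_left_inj (hc _)]⟩
  refine congrArg _
    (Nat.card_congr (Equiv.ofBijective φ ⟨fun g h hgh => ?_, fun ⟨l, hl⟩ => ?_⟩)).symm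
  · refine Subtype.ext (funext fun q => ?_)
    exact Finsupp.single_left_injective (hc q) (DFunLike.congr_fun (congrArg Subtype.val hgh) q)
  · obtain ⟨hl, hsingle⟩ := Finset.mem_filter.1 hl
    choose g hg using hsingle
    refine ⟨⟨g, ?_⟩, Subtype.ext (Finsupp.ext fun q => (hg q).symm)⟩
    rw [← (Finset.mem_finsuppAntidiag.1 hl).1]
    exact Finset.sum_congr rfl fun q _ => (hg q).symm

theorem coeff_prod_map_powerSum {ι : Type*} [Fintype ι] [DecidableEq ι] (w : Equiv.Perm ι)
    (d : ℕ →₀ ℕ) :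
    MvPowerSeries.coeff d (w.partition.parts.map powerSum).prod =
      Nat.card {g : ι → ℕ // g ∘ w = g ∧ content g = d} := by
  rw [prod_map_parts_partition, coeff_prod_powerSum cycleLength_ne_zero]
  refine congrArg _ (Nat.card_congr ?_)
  refine Equiv.trans ?_ (Equiv.subtypeSubtypeEquivSubtypeInter _ _)
  exact (invariantEquiv w ℕ).symm.subtypeEquiv fun h => by
    rw [← content_comp_cycleThrough]; rfl

end PowerSum

section Frobenius

open Equiv

theorem coeff_coeff_complSym_pow (α : Type*) [Fintype α] [DecidableEq α] (n : ℕ) (d : ℕ →₀ ℕ) :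
    MvPowerSeries.coeff d (PowerSeries.coeff n (PowerSeries.mk complSym ^ Fintype.card α)) =
      if d.degree = n then ((Finset.univ : Finset α).finsuppAntidiag d).card else 0 := by
  classical
  have hcoeff : ∀ k (e : ℕ →₀ ℕ), MvPowerSeries.coeff e (complSym k) =
      if e.degree = k then 1 else 0 := fun _ _ => rfl
  have hpow : PowerSeries.mk complSym ^ Fintype.card α = ∏ _a : α, PowerSeries.mk complSym :=
    (Finset.prod_const _).symm
  have hdegrees : ∀ l ∈ (Finset.univ : Finset α).finsuppAntidiag d,
      (∑ x ∈ Finset.univ.finsuppAntidiag n, if ∀ a, (l a).degree = x a then (1 : ℚ) else 0) =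
        if d.degree = n then 1 else 0 := by
    intro l hl
    have hx : ∀ x : α →₀ ℕ, (∀ a, (l a).degree = x a) ↔
        Finsupp.equivFunOnFinite.symm (fun a => (l a).degree) = x := fun x => by
      simp [Finsupp.ext_iff]
    simp only [hx, Finset.sum_ite_eq, Finset.mem_finsuppAntidiag, Finset.subset_univ, and_true,
      ← (Finset.mem_finsuppAntidiag.1 hl).1, map_sum, Finsupp.equivFunOnFinite_symm_apply_apply]
  rw [hpow, PowerSeries.coeff_prod, map_sum]
  simp only [MvPowerSeries.coeff_prod, PowerSeries.coeff_mk, hcoeff, Fintype.prod_boole]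
  rw [Finset.sum_comm, Finset.sum_congr rfl hdegrees]
  split_ifs <;> simp

theorem sum_curry {α σ : Type*} [Fintype α] (E : α × σ →₀ ℕ) :
    ∑ a, E.curry a = E.mapDomain Prod.snd := by
  classical
  have hadd : ∀ (f g : α × σ →₀ ℕ) a, (f + g).curry a = f.curry a + g.curry a := fun _ _ _ => by
    ext; simp
  induction E using Finsupp.induction_linear with
  | zero => exact Finset.sum_eq_zero fun a _ => Finsupp.ext fun _ => by simp
  | add f g hf hg => simp only [hadd, Finset.sum_add_distrib, hf, hg, Finsupp.mapDomain_add]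
  | single a m => simp [Finsupp.single_apply]

theorem card_invariant_prod {ι α : Type*} [Fintype ι] [DecidableEq α] [Fintype α] (w : Perm ι)
    (d : ℕ →₀ ℕ) :
    Nat.card {f : ι → α // f ∘ w = f} * Nat.card {g : ι → ℕ // g ∘ w = g ∧ content g = d} =
      ∑ l ∈ (Finset.univ : Finset α).finsuppAntidiag d,
        Nat.card {F : ι → α × ℕ // content F = l.uncurry ∧ F ∘ w = F} := by
  have hcurry : ∀ F : ι → α × ℕ, content (Prod.snd ∘ F) = d ↔
      (content F).curry ∈ (Finset.univ : Finset α).finsuppAntidiag d := fun F => by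
    simp [sum_curry, mapDomain_content]
  have hinv : ∀ F : ι → α × ℕ, F ∘ w = F ↔
      (Prod.fst ∘ F) ∘ w = Prod.fst ∘ F ∧ (Prod.snd ∘ F) ∘ w = Prod.snd ∘ F := fun F => by
    simp [funext_iff, Prod.ext_iff, forall_and]
  let e₁ : {f : ι → α // f ∘ w = f} × {g : ι → ℕ // g ∘ w = g ∧ content g = d} ≃
      {F : ι → α × ℕ // F ∘ w = F ∧
        (content F).curry ∈ (Finset.univ : Finset α).finsuppAntidiag d} :=
    (subtypeProdEquivProd (p := fun f : ι → α => f ∘ w = f)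
      (q := fun g : ι → ℕ => g ∘ w = g ∧ content g = d)).symm.trans <|
      (arrowProdEquivProdArrow ι (fun _ => α) (fun _ => ℕ)).symm.subtypeEquiv fun p => by
        rw [hinv, ← hcurry, and_assoc]; rfl
  let e₂ : {F : ι → α × ℕ // F ∘ w = F ∧
        (content F).curry ∈ (Finset.univ : Finset α).finsuppAntidiag d} ≃
      Σ l : (Finset.univ : Finset α).finsuppAntidiag d,
        {F : ι → α × ℕ // content F = l.1.uncurry ∧ F ∘ w = F} :=
    { toFun F := ⟨⟨_, F.2.2⟩, F.1, (Finsupp.uncurry_curry _).symm, F.2.1⟩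
      invFun p := ⟨p.2.1, p.2.2.2, by rw [p.2.2.1, Finsupp.curry_uncurry]; exact p.1.2⟩
      left_inv _ := rfl
      right_inv := by
        rintro ⟨⟨l, hl⟩, F, hF, hw⟩
        obtain rfl : (content F).curry = l := by rw [hF, Finsupp.curry_uncurry]
        rfl }
  have : ∀ E : α × ℕ →₀ ℕ, Finite {F : ι → α × ℕ // content F = E ∧ F ∘ w = F} := fun E =>
    .of_injective (Subtype.map id fun _ h => h.1 : _ → {F : ι → α × ℕ // content F = E})
      (Subtype.map_injective _ Function.injective_id)
  rw [← Nat.card_prod, Nat.card_congr (e₁.trans e₂), Nat.card_sigma]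
  exact Finset.sum_coe_sort (Finset.univ.finsuppAntidiag d) fun l =>
    Nat.card {F : ι → α × ℕ // content F = l.uncurry ∧ F ∘ w = F}

theorem frobeniusChar_card_invariant (n : ℕ) (α : Type*) [Fintype α] :
    frobeniusChar (fun w : Perm (Fin n) => (Nat.card {f : Fin n → α // f ∘ w = f} : ℚ)) =
      PowerSeries.coeff n (PowerSeries.mk complSym ^ Fintype.card α) := by
  classical
  have hdegree : ∀ (d : ℕ →₀ ℕ), ∀ l ∈ (Finset.univ : Finset α).finsuppAntidiag d,
      l.uncurry.degree = d.degree := by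
    intro d l hl
    rw [← Finsupp.degree_mapDomain Prod.snd, ← sum_curry, Finsupp.curry_uncurry,
      (Finset.mem_finsuppAntidiag.1 hl).1]
  ext d
  rw [coeff_coeff_complSym_pow, frobeniusChar, map_smul, map_sum, smul_eq_mul,
    inv_mul_eq_iff_eq_mul₀ (Nat.cast_ne_zero.2 n.factorial_ne_zero)]
  simp only [map_smul, coeff_prod_map_powerSum, smul_eq_mul, ← Nat.cast_mul, card_invariant_prod]
  rw [← Nat.cast_sum, Nat.cast_inj, Finset.sum_comm]
  split_ifs with hd
  · rw [Finset.sum_congr rfl fun l hl => sum_card_invariant_word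
      (by rw [hdegree d l hl, hd, Fintype.card_fin]), Finset.sum_const, Fintype.card_fin,
      smul_eq_mul, mul_comm]
  · refine Finset.sum_eq_zero fun l hl => Finset.sum_eq_zero fun w _ => ?_
    have : IsEmpty {F : Fin n → α × ℕ // content F = l.uncurry ∧ F ∘ w = F} := ⟨fun F => hd <| by
      rw [← hdegree d l hl, ← F.2.1, degree_content, Fintype.card_fin]⟩
    exact Nat.card_of_isEmpty

theorem parkingSym_eq (n : ℕ) :
    parkingSym n =
      ((n + 1 : ℕ) : ℚ)⁻¹ • PowerSeries.coeff n (PowerSeries.mk complSym ^ (n + 1)) := by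
  have h := frobeniusChar_card_invariant n (ZMod (n + 1))
  rw [ZMod.card] at h
  rw [← h, frobeniusChar, parkingSym, frobeniusChar, smul_comm]
  refine congrArg _ ?_
  rw [Finset.smul_sum]
  refine Finset.sum_congr rfl fun w _ => ?_
  rw [smul_smul, ← card_fixedBy_parking, Nat.cast_mul, mul_comm,
    mul_inv_cancel_right₀ (by positivity)]

end Frobenius

section Generators

open PowerSeries
open Finset.HasAntidiagonal (antidiagonal mem_antidiagonal)

theorem coeff_elemSym (d : ℕ →₀ ℕ) [Decidable (∀ i, d i ≤ 1)] (k : ℕ) :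
    MvPowerSeries.coeff d (elemSym k) = if d.degree = k ∧ ∀ i, d i ≤ 1 then 1 else 0 := by
  rw [MvPowerSeries.coeff_apply, elemSym]
  congr

theorem coeff_complSym (d : ℕ →₀ ℕ) (k : ℕ) :
    MvPowerSeries.coeff d (complSym k) = if d.degree = k then 1 else 0 :=
  rfl

theorem elemSym_zero : elemSym 0 = 1 := by
  classical
  ext d
  rw [coeff_elemSym, MvPowerSeries.coeff_one]
  refine if_congr ⟨fun h => (Finsupp.degree_eq_zero_iff d).1 h.1, ?_⟩ rfl rfl
  rintro rfl
  simp

theorem complSym_zero : complSym 0 = 1 := by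
  classical
  ext d
  rw [coeff_complSym, MvPowerSeries.coeff_one]
  exact if_congr (Finsupp.degree_eq_zero_iff d) rfl rfl

theorem elemSym_mem (n : ℕ) : elemSym n ∈ symFun := by
  rcases n with _ | n
  · rw [elemSym_zero]
    exact one_mem _
  · exact Algebra.subset_adjoin ⟨n, rfl⟩

theorem degree_eq_card_support {σ : Type*} {a : σ →₀ ℕ} (ha : ∀ i, a i ≤ 1) :
    a.degree = a.support.card := by
  rw [Finsupp.degree_apply, Finset.card_eq_sum_ones]
  refine Finset.sum_congr rfl fun i hi => ?_
  have := ha i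
  have := Finsupp.mem_support_iff.1 hi
  omega

theorem sum_antidiagonal_neg_one_pow_degree {σ : Type*} [DecidableEq σ] (d : σ →₀ ℕ)
    [DecidablePred fun a : σ →₀ ℕ => ∀ i, a i ≤ 1] :
    ∑ p ∈ antidiagonal d with ∀ i, p.1 i ≤ 1, (-1 : ℤ) ^ p.1.degree = if d = 0 then 1 else 0 := by
  simp only [← Finsupp.support_eq_empty, ← Finset.sum_powerset_neg_one_pow_card]
  let ind : Finset σ → σ →₀ ℕ := fun s => Finsupp.indicator s fun _ _ => 1
  have hind : ∀ s i, ind s i = if i ∈ s then 1 else 0 := fun s i => by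
    simp [ind, Finsupp.indicator_apply]
  have hind_support : ∀ a : σ →₀ ℕ, (∀ i, a i ≤ 1) → ind a.support = a := fun a ha =>
    Finsupp.ext fun i => by
      have := ha i
      simp only [hind, Finsupp.mem_support_iff]
      split_ifs <;> omega
  have hind_le : ∀ s ⊆ d.support, ind s ≤ d := fun s hs i => by
    rw [hind]
    split_ifs with hi
    · exact Nat.one_le_iff_ne_zero.2 (Finsupp.mem_support_iff.1 (hs hi))
    · exact Nat.zero_le _
  refine Finset.sum_nbij' (fun p => p.1.support) (fun s => (ind s, d - ind s)) ?_ ?_ ?_ ?_ ?_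
  · intro p hp
    rw [Finset.mem_powerset, ← mem_antidiagonal.1 (Finset.mem_filter.1 hp).1]
    exact Finsupp.support_mono le_self_add
  · intro s hs
    rw [Finset.mem_filter, mem_antidiagonal]
    refine ⟨add_tsub_cancel_of_le (hind_le s (Finset.mem_powerset.1 hs)), fun i => ?_⟩
    rw [hind]
    split_ifs <;> simp
  · intro p hp
    obtain ⟨hp, hsq⟩ := Finset.mem_filter.1 hp
    rw [hind_support _ hsq, ← mem_antidiagonal.1 hp, add_tsub_cancel_left]
  · intro s _
    ext i
    simp [hind]
  · intro p hp
    rw [degree_eq_card_support (Finset.mem_filter.1 hp).2]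

theorem rescale_mk_elemSym_mul_mk_complSym :
    rescale (-1) (PowerSeries.mk elemSym) * PowerSeries.mk complSym = 1 := by
  classical
  ext n d
  have hterm : ∀ (p : (ℕ →₀ ℕ) × (ℕ →₀ ℕ)) (q : ℕ × ℕ),
      MvPowerSeries.coeff p.1 ((-1) ^ q.1 * elemSym q.1) *
          MvPowerSeries.coeff p.2 (complSym q.2) =
        if (p.1.degree, p.2.degree) = q then
          if ∀ i, p.1 i ≤ 1 then (-1) ^ p.1.degree else 0 else 0 := by
    rintro ⟨a, b⟩ ⟨i, j⟩
    have hsign : ((-1) ^ i : MvPowerSeries ℕ ℚ) = MvPowerSeries.C ((-1) ^ i) := by simp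
    rw [hsign, MvPowerSeries.coeff_C_mul, coeff_elemSym, coeff_complSym]
    grind
  have hdeg : ∀ p ∈ antidiagonal d,
      ((p.1.degree, p.2.degree) ∈ antidiagonal n ↔ d.degree = n) := fun p hp => by
    rw [mem_antidiagonal, ← map_add, mem_antidiagonal.1 hp]
  rw [coeff_mul, map_sum, Finset.sum_congr rfl fun q _ => MvPowerSeries.coeff_mul _ _ _]
  simp only [coeff_rescale, coeff_mk, hterm]
  rw [Finset.sum_comm]
  simp only [Finset.sum_ite_eq]
  have hsum := congrArg (Int.cast : ℤ → ℚ) (sum_antidiagonal_neg_one_pow_degree d)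
  push_cast at hsum
  rw [Finset.sum_congr rfl fun p hp => if_congr (hdeg p hp) rfl rfl, Finset.sum_ite_irrel,
    ← Finset.sum_filter, hsum, coeff_one, Finset.sum_const_zero]
  by_cases hd : d = 0
  · simp [hd, apply_ite, eq_comm (a := n)]
  · simp [hd, apply_ite, MvPowerSeries.coeff_one]

/-- The generating series `E(t) = ∑ e_n t^n` over `Λ_ℚ`. -/
noncomputable def elemSeries : symFun⟦X⟧ :=
  PowerSeries.mk fun n => ⟨elemSym n, elemSym_mem n⟩

theorem constantCoeff_elemSeries : constantCoeff elemSeries = 1 :=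
  Subtype.ext elemSym_zero

/-- The generating series `H(t) = ∑ h_n t^n` over `Λ_ℚ`, in the form `1 / E(-t)`. -/
noncomputable def complSeries : symFun⟦X⟧ := invOfUnit (rescale (-1) elemSeries) 1

theorem rescale_elemSeries_mul_complSeries : rescale (-1) elemSeries * complSeries = 1 :=
  mul_invOfUnit _ _ (by
    rw [← coeff_zero_eq_constantCoeff_apply, coeff_rescale, pow_zero, one_mul,
      coeff_zero_eq_constantCoeff_apply, constantCoeff_elemSeries, Units.val_one])

theorem map_val_elemSeries :
    PowerSeries.map symFun.val.toRingHom elemSeries = PowerSeries.mk elemSym :=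
  rfl

theorem map_rescale_neg_one {R S : Type*} [CommRing R] [CommRing S] (φ : R →+* S) (F : R⟦X⟧) :
    PowerSeries.map φ (rescale (-1) F) = rescale (-1) (PowerSeries.map φ F) := by
  ext n
  simp

theorem map_val_complSeries :
    PowerSeries.map symFun.val.toRingHom complSeries = PowerSeries.mk complSym := by
  have h := congrArg (PowerSeries.map symFun.val.toRingHom) rescale_elemSeries_mul_complSeries
  rw [map_mul, map_one, map_rescale_neg_one, map_val_elemSeries, mul_comm] at h
  exact left_inv_eq_right_inv h rescale_mk_elemSym_mul_mk_complSym

end Generators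

section Lift

open PowerSeries

variable {A : Type*} [CommRing A] [Algebra ℚ A] {F : A⟦X⟧}

/-- The algebra homomorphism on `Λ_ℚ` that sends `E(t)` to a given series `F` with constant
coefficient `1`; the actual constant coefficient of `F` is ignored. -/
noncomputable def symFunLift (F : A⟦X⟧) : symFun →ₐ[ℚ] A :=
  (MvPolynomial.aeval fun i : ℕ => coeff (i + 1) F).comp
    elemSym_algebraicIndependent.aevalEquiv.symm.toAlgHom

theorem map_symFunLift_elemSeries (hF : constantCoeff F = 1) :
    PowerSeries.map (symFunLift F).toRingHom elemSeries = F := by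
  ext n
  rw [coeff_map]
  rcases n with _ | n
  · rw [coeff_zero_eq_constantCoeff_apply, coeff_zero_eq_constantCoeff_apply,
      constantCoeff_elemSeries, map_one, hF]
  · have h : coeff (n + 1) elemSeries =
        elemSym_algebraicIndependent.aevalEquiv (MvPolynomial.X n) :=
      Subtype.ext (by simp [elemSeries])
    change MvPolynomial.aeval _ (elemSym_algebraicIndependent.aevalEquiv.symm _) = _
    rw [h, AlgEquiv.symm_apply_apply, MvPolynomial.aeval_X]

theorem rescale_mul_map_symFunLift_complSeries (hF : constantCoeff F = 1) :
    rescale (-1) F * PowerSeries.map (symFunLift F).toRingHom complSeries = 1 := by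
  have h := congrArg (PowerSeries.map (symFunLift F).toRingHom) rescale_elemSeries_mul_complSeries
  rwa [map_mul, map_one, map_rescale_neg_one, map_symFunLift_elemSeries hF] at h

theorem omega_elemSym_mem (n : ℕ) : omega ⟨elemSym n, elemSym_mem n⟩ = complSym n := by
  have homega : omega = symFunLift (PowerSeries.mk complSym) := by
    simp only [omega, symFunLift, coeff_mk]
  have hzero : constantCoeff (PowerSeries.mk complSym) = 1 := complSym_zero
  have h := congrArg (coeff n) (map_symFunLift_elemSeries hzero)
  rwa [← homega, coeff_map, elemSeries, coeff_mk, coeff_mk] at h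

end Lift

section Superfication

open PowerSeries
open Finset.HasAntidiagonal (antidiagonal mem_antidiagonal)
open Function.Embedding (inl inr)

theorem coeff_coeffX (a b : ℕ →₀ ℕ) (F : MvPowerSeries (ℕ ⊕ ℕ) ℚ) :
    MvPowerSeries.coeff b (coeffX a F) = MvPowerSeries.coeff (Finsupp.sumElim a b) F :=
  rfl

theorem ext_coeffX {F G : MvPowerSeries (ℕ ⊕ ℕ) ℚ} (h : ∀ a, coeffX a F = coeffX a G) :
    F = G := by
  ext d
  obtain ⟨⟨a, b⟩, rfl⟩ := Finsupp.sumFinsuppEquivProdFinsupp.symm.surjective d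
  exact congrArg (MvPowerSeries.coeff b) (h a)

theorem coeffX_mul (a : ℕ →₀ ℕ) (F G : MvPowerSeries (ℕ ⊕ ℕ) ℚ) :
    coeffX a (F * G) = ∑ u ∈ antidiagonal a, coeffX u.1 F * coeffX u.2 G := by
  ext b
  let e := Finsupp.sumFinsuppAddEquivProdFinsupp (M := ℕ) (α := ℕ) (β := ℕ)
  have he : ∀ d, Finsupp.sumElim (e d).1 (e d).2 = d := e.symm_apply_apply
  have he' : ∀ u v, e (Finsupp.sumElim u v) = (u, v) := fun u v => e.apply_symm_apply (u, v)
  simp only [map_sum, coeff_coeffX, MvPowerSeries.coeff_mul, ← Finset.sum_product']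
  refine Finset.sum_bij' (fun d _ => (((e d.1).1, (e d.2).1), ((e d.1).2, (e d.2).2)))
    (fun u _ => (Finsupp.sumElim u.1.1 u.2.1, Finsupp.sumElim u.1.2 u.2.2)) ?_ ?_ ?_ ?_ ?_
  · intro d hd
    have h := congrArg e (mem_antidiagonal.1 hd)
    rw [map_add, he'] at h
    exact Finset.mem_product.2 ⟨mem_antidiagonal.2 (congrArg Prod.fst h),
      mem_antidiagonal.2 (congrArg Prod.snd h)⟩
  · intro u hu
    simp only [Finset.mem_product, mem_antidiagonal] at hu ⊢
    rw [← Finsupp.sumElim_add, hu.1, hu.2]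
  · intro d _
    simp only [he]
  · intro u _
    simp only [he']
  · intro d _
    simp only [he]

theorem coeffX_rename_inl (a : ℕ →₀ ℕ) (f : MvPowerSeries ℕ ℚ) :
    coeffX a (MvPowerSeries.rename (inl : ℕ ↪ ℕ ⊕ ℕ) f) = MvPowerSeries.coeff a f • 1 := by
  classical
  ext b
  rw [coeff_coeffX, MvPowerSeries.coeff_smul, MvPowerSeries.coeff_one]
  split_ifs with hb
  · rw [hb, ← Finsupp.embDomain_inl, MvPowerSeries.coeff_embDomain_rename, mul_one]
  · rw [MvPowerSeries.coeff_rename_eq_zero, mul_zero]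
    rintro ⟨u, hu⟩
    rw [← Finsupp.embDomain_eq_mapDomain, Finsupp.embDomain_inl] at hu
    exact hb (Finsupp.ext fun i => (DFunLike.congr_fun hu (Sum.inr i)).symm)

theorem coeffX_rename_inr [DecidableEq (ℕ →₀ ℕ)] (a : ℕ →₀ ℕ) (f : MvPowerSeries ℕ ℚ) :
    coeffX a (MvPowerSeries.rename (inr : ℕ ↪ ℕ ⊕ ℕ) f) = if a = 0 then f else 0 := by
  ext b
  rw [coeff_coeffX]
  split_ifs with ha
  · rw [ha, ← Finsupp.embDomain_inr, MvPowerSeries.coeff_embDomain_rename]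
  · rw [MvPowerSeries.coeff_rename_eq_zero, map_zero]
    rintro ⟨u, hu⟩
    rw [← Finsupp.embDomain_eq_mapDomain, Finsupp.embDomain_inr] at hu
    exact ha (Finsupp.ext fun i => (DFunLike.congr_fun hu (Sum.inl i)).symm)

theorem coeffX_rename_inl_mul_rename_inr (a : ℕ →₀ ℕ) (f g : MvPowerSeries ℕ ℚ) :
    coeffX a (MvPowerSeries.rename (inl : ℕ ↪ ℕ ⊕ ℕ) f * MvPowerSeries.rename (inr : ℕ ↪ ℕ ⊕ ℕ) g) =
      MvPowerSeries.coeff a f • g := by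
  classical
  simp only [coeffX_mul, coeffX_rename_inl, coeffX_rename_inr]
  rw [Finset.sum_eq_single (a, 0)]
  · simp
  · rintro ⟨u, v⟩ huv hne
    rw [if_neg, mul_zero]
    rintro rfl
    rw [mem_antidiagonal, add_zero] at huv
    exact hne (by rw [← huv])
  · simp

theorem coeff_twoAlphabets (d : ℕ ⊕ ℕ →₀ ℕ) (f : MvPowerSeries ℕ ℚ) :
    MvPowerSeries.coeff d (twoAlphabets f) =
      MvPowerSeries.coeff (d.equivMapDomain Equiv.natSumNatEquivNat) f := by
  have hd : Finsupp.embDomain Equiv.natSumNatEquivNat.symm.toEmbedding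
      (d.equivMapDomain Equiv.natSumNatEquivNat) = d := by
    rw [Finsupp.embDomain_eq_mapDomain, Equiv.coe_toEmbedding,
      ← Finsupp.equivMapDomain_eq_mapDomain, ← Finsupp.equivMapDomain_trans,
      Equiv.self_trans_symm, Finsupp.equivMapDomain_refl]
  conv_lhs => rw [← hd]
  exact MvPowerSeries.coeff_embDomain_rename Equiv.natSumNatEquivNat.symm.toEmbedding f _

theorem twoAlphabets_elemSym (n : ℕ) :
    twoAlphabets (elemSym n) = ∑ p ∈ antidiagonal n,
      MvPowerSeries.rename (inl : ℕ ↪ ℕ ⊕ ℕ) (elemSym p.1) *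
        MvPowerSeries.rename (inr : ℕ ↪ ℕ ⊕ ℕ) (elemSym p.2) := by
  classical
  refine ext_coeffX fun a => MvPowerSeries.ext fun b => ?_
  have hdegree : ((Finsupp.sumElim a b).equivMapDomain Equiv.natSumNatEquivNat).degree =
      a.degree + b.degree := by
    rw [Finsupp.equivMapDomain_eq_mapDomain, Finsupp.degree_mapDomain, Finsupp.sumElim_eq_add,
      map_add, Finsupp.degree_mapDomain, Finsupp.degree_mapDomain]
  have hsquarefree : (∀ i, (Finsupp.sumElim a b).equivMapDomain Equiv.natSumNatEquivNat i ≤ 1) ↔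
      (∀ i, a i ≤ 1) ∧ ∀ i, b i ≤ 1 := by
    rw [← Equiv.natSumNatEquivNat.forall_congr_right, Sum.forall]
    simp only [Finsupp.equivMapDomain_apply, Equiv.symm_apply_apply, Finsupp.sumElim_inl,
      Finsupp.sumElim_inr]
  have hterm : ∀ p : ℕ × ℕ, MvPowerSeries.coeff a (elemSym p.1) *
      MvPowerSeries.coeff b (elemSym p.2) = if (a.degree, b.degree) = p then
        if (∀ i, a i ≤ 1) ∧ ∀ i, b i ≤ 1 then 1 else 0 else 0 := by
    rintro ⟨i, j⟩
    rw [coeff_elemSym, coeff_elemSym]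
    grind
  rw [coeff_coeffX, coeff_twoAlphabets, coeff_elemSym, coeff_coeffX, map_sum]
  simp only [← coeff_coeffX, coeffX_rename_inl_mul_rename_inr, MvPowerSeries.coeff_smul, hterm,
    Finset.sum_ite_eq, mem_antidiagonal, hdegree, hsquarefree, ite_and]

/-- `G` is `ω_y F`, where all the coefficients that `ω` is applied to are in `Λ_ℚ`. -/
def IsOmegaY (F G : MvPowerSeries (ℕ ⊕ ℕ) ℚ) : Prop :=
  ∀ a, ∃ h : coeffX a F ∈ symFun, coeffX a G = omega ⟨coeffX a F, h⟩

theorem IsOmegaY.omegaY_eq {F G : MvPowerSeries (ℕ ⊕ ℕ) ℚ} (h : IsOmegaY F G) :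
    omegaY F = G := by
  refine ext_coeffX fun a => MvPowerSeries.ext fun b => ?_
  obtain ⟨hF, hG⟩ := h a
  have hab := Finsupp.sumFinsuppEquivProdFinsupp.apply_symm_apply (a, b)
  have ha : (Finsupp.sumFinsuppEquivProdFinsupp (Finsupp.sumElim a b)).1 = a :=
    congrArg Prod.fst hab
  have hb : (Finsupp.sumFinsuppEquivProdFinsupp (Finsupp.sumElim a b)).2 = b :=
    congrArg Prod.snd hab
  rw [hG, coeff_coeffX, MvPowerSeries.coeff_apply, omegaY]
  simp only [hb]
  rw [dif_pos (by rwa [ha])]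
  simp only [ha]

theorem IsOmegaY.add {F G F' G' : MvPowerSeries (ℕ ⊕ ℕ) ℚ} (h : IsOmegaY F G)
    (h' : IsOmegaY F' G') : IsOmegaY (F + F') (G + G') := by
  intro a
  obtain ⟨hF, hG⟩ := h a
  obtain ⟨hF', hG'⟩ := h' a
  refine ⟨add_mem hF hF', ?_⟩
  calc coeffX a (G + G') = coeffX a G + coeffX a G' := rfl
    _ = omega (⟨_, hF⟩ + ⟨_, hF'⟩) := by rw [hG, hG', map_add]

theorem IsOmegaY.sum {ι : Type*} {s : Finset ι} {F G : ι → MvPowerSeries (ℕ ⊕ ℕ) ℚ}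
    (h : ∀ i ∈ s, IsOmegaY (F i) (G i)) : IsOmegaY (∑ i ∈ s, F i) (∑ i ∈ s, G i) := by
  rw [← Prod.fst_sum (f := fun i => (F i, G i)), ← Prod.snd_sum (f := fun i => (F i, G i))]
  refine Finset.sum_induction _ (fun p : _ × _ => IsOmegaY p.1 p.2) (fun _ _ => IsOmegaY.add) ?_ h
  exact fun a => ⟨zero_mem _, (map_zero omega).symm⟩

theorem IsOmegaY.mul {F G F' G' : MvPowerSeries (ℕ ⊕ ℕ) ℚ} (h : IsOmegaY F G)
    (h' : IsOmegaY F' G') : IsOmegaY (F * F') (G * G') := by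
  choose hF hG using h
  choose hF' hG' using h'
  intro a
  have hmul : coeffX a (F * F') = ((∑ u ∈ antidiagonal a,
      (⟨coeffX u.1 F, hF u.1⟩ : symFun) * ⟨coeffX u.2 F', hF' u.2⟩ : symFun) :
        MvPowerSeries ℕ ℚ) := by
    rw [coeffX_mul]
    push_cast
    rfl
  refine ⟨hmul ▸ Subtype.prop _, ?_⟩
  simp only [coeffX_mul a G G', hmul, hG, hG', Subtype.coe_eta, map_sum, map_mul]

theorem isOmegaY_rename_inl_mul_rename_inr (f : MvPowerSeries ℕ ℚ) (g : symFun) :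
    IsOmegaY
      (MvPowerSeries.rename (inl : ℕ ↪ ℕ ⊕ ℕ) f * MvPowerSeries.rename (inr : ℕ ↪ ℕ ⊕ ℕ) g.1)
      (MvPowerSeries.rename (inl : ℕ ↪ ℕ ⊕ ℕ) f *
        MvPowerSeries.rename (inr : ℕ ↪ ℕ ⊕ ℕ) (omega g)) := by
  intro a
  have h := coeffX_rename_inl_mul_rename_inr a f g.1
  refine ⟨h ▸ (MvPowerSeries.coeff a f • g).2, ?_⟩
  simp only [h, coeffX_rename_inl_mul_rename_inr, ← map_smul]
  rfl

/-- `f` is a symmetric function whose shiftification is `g`. -/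
def IsShiftification (f g : MvPowerSeries ℕ ℚ) : Prop :=
  ∃ G, IsOmegaY (twoAlphabets f) G ∧
    MvPowerSeries.rename (Sum.elim id id : ℕ ⊕ ℕ → ℕ) G = g

theorem IsShiftification.shiftification_eq {f g : MvPowerSeries ℕ ℚ} (h : IsShiftification f g) :
    shiftification f = g := by
  obtain ⟨G, hG, rfl⟩ := h
  rw [shiftification, superfication, hG.omegaY_eq]

theorem IsShiftification.add {f g f' g' : MvPowerSeries ℕ ℚ} (h : IsShiftification f g)
    (h' : IsShiftification f' g') : IsShiftification (f + f') (g + g') := by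
  obtain ⟨G, hG, rfl⟩ := h
  obtain ⟨G', hG', rfl⟩ := h'
  exact ⟨G + G', by rw [twoAlphabets, map_add]; exact hG.add hG', map_add _ _ _⟩

theorem IsShiftification.mul {f g f' g' : MvPowerSeries ℕ ℚ} (h : IsShiftification f g)
    (h' : IsShiftification f' g') : IsShiftification (f * f') (g * g') := by
  obtain ⟨G, hG, rfl⟩ := h
  obtain ⟨G', hG', rfl⟩ := h'
  exact ⟨G * G', by rw [twoAlphabets, map_mul]; exact hG.mul hG', map_mul _ _ _⟩

theorem rename_fold_rename_inl (f : MvPowerSeries ℕ ℚ) :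
    MvPowerSeries.rename (Sum.elim id id : ℕ ⊕ ℕ → ℕ)
      (MvPowerSeries.rename (inl : ℕ ↪ ℕ ⊕ ℕ) f) = f := by
  rw [MvPowerSeries.rename_rename]
  exact MvPowerSeries.rename_id_apply f

theorem rename_fold_rename_inr (f : MvPowerSeries ℕ ℚ) :
    MvPowerSeries.rename (Sum.elim id id : ℕ ⊕ ℕ → ℕ)
      (MvPowerSeries.rename (inr : ℕ ↪ ℕ ⊕ ℕ) f) = f := by
  rw [MvPowerSeries.rename_rename]
  exact MvPowerSeries.rename_id_apply f

theorem isShiftification_algebraMap (c : ℚ) :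
    IsShiftification (algebraMap ℚ _ c) (algebraMap ℚ _ c) := by
  have h := isOmegaY_rename_inl_mul_rename_inr (algebraMap ℚ _ c) 1
  simp only [map_one, OneMemClass.coe_one, mul_one, AlgHom.commutes] at h
  exact ⟨_, by rwa [twoAlphabets, AlgHom.commutes], AlgHom.commutes _ c⟩

theorem isShiftification_elemSym (n : ℕ) :
    IsShiftification (elemSym n) (∑ p ∈ antidiagonal n, elemSym p.1 * complSym p.2) := by
  refine ⟨∑ p ∈ antidiagonal n, MvPowerSeries.rename (inl : ℕ ↪ ℕ ⊕ ℕ) (elemSym p.1) *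
    MvPowerSeries.rename (inr : ℕ ↪ ℕ ⊕ ℕ) (complSym p.2), ?_, ?_⟩
  · rw [twoAlphabets_elemSym]
    refine IsOmegaY.sum fun p _ => ?_
    have h := isOmegaY_rename_inl_mul_rename_inr (elemSym p.1) ⟨elemSym p.2, elemSym_mem p.2⟩
    rwa [omega_elemSym_mem] at h
  · simp only [map_sum, map_mul, rename_fold_rename_inl, rename_fold_rename_inr]

end Superfication

section Schur

open PowerSeries
open Finset.HasAntidiagonal (antidiagonal)

/-- The generating series `Q(t) = E(t) H(t) = 1 + 2 ∑ P_n t^n` over `Λ_ℚ`. -/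
noncomputable def schurSeries : symFun⟦X⟧ := elemSeries * complSeries

theorem coe_coeff_schurSeries (n : ℕ) :
    ((coeff n schurSeries : symFun) : MvPowerSeries ℕ ℚ) =
      ∑ p ∈ antidiagonal n, elemSym p.1 * complSym p.2 := by
  have h : PowerSeries.map symFun.val.toRingHom schurSeries =
      PowerSeries.mk elemSym * PowerSeries.mk complSym := by
    rw [schurSeries, map_mul, map_val_elemSeries, map_val_complSeries]
  have hn := congrArg (coeff n) h
  simp only [coeff_mul, coeff_mk] at hn
  exact hn

theorem coe_coeff_schurSeries_eq_smul_schurP (n : ℕ) :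
    ((coeff n schurSeries : symFun) : MvPowerSeries ℕ ℚ) = (2 : ℚ) • schurP n := by
  rw [coe_coeff_schurSeries, schurP, smul_smul,
    Finset.Nat.sum_antidiagonal_eq_sum_range_succ_mk]
  norm_num

theorem constantCoeff_schurSeries : constantCoeff schurSeries = 1 := by
  rw [← coeff_zero_eq_constantCoeff_apply]
  refine Subtype.ext ?_
  rw [coe_coeff_schurSeries, Finset.Nat.antidiagonal_zero, Finset.sum_singleton, elemSym_zero,
    complSym_zero, one_mul, OneMemClass.coe_one]

theorem rescale_schurSeries_mul_schurSeries : rescale (-1) schurSeries * schurSeries = 1 := by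
  have hsq : (-1 : symFun) * -1 = 1 := by ring
  have h := congrArg (rescale (-1 : symFun)) rescale_elemSeries_mul_complSeries
  rw [map_mul, map_one, rescale_rescale, hsq, rescale_one, RingHom.id_apply] at h
  rw [schurSeries, map_mul]
  linear_combination elemSeries * rescale (-1) complSeries * rescale_elemSeries_mul_complSeries + h

theorem map_symFunLift_schurSeries_complSeries :
    PowerSeries.map (symFunLift schurSeries).toRingHom complSeries = schurSeries :=
  left_inv_eq_right_inv (a := rescale (-1) schurSeries)
    ((mul_comm _ _).trans (rescale_mul_map_symFunLift_complSeries constantCoeff_schurSeries))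
    rescale_schurSeries_mul_schurSeries

theorem shiftification_eq_symFunLift (f : symFun) :
    shiftification f = symFunLift schurSeries f := by
  refine IsShiftification.shiftification_eq ?_
  obtain ⟨f, hf⟩ := f
  induction hf using Algebra.adjoin_induction with
  | mem f hf =>
    obtain ⟨i, rfl⟩ := hf
    have h := congrArg (coeff (i + 1)) (map_symFunLift_elemSeries constantCoeff_schurSeries)
    rw [coeff_map, elemSeries, coeff_mk] at h
    change IsShiftification (elemSym (i + 1)) ((symFunLift schurSeries).toRingHom _)
    rw [h, coe_coeff_schurSeries]
    exact isShiftification_elemSym (i + 1)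
  | algebraMap c =>
    have h : symFunLift schurSeries ⟨algebraMap ℚ _ c, symFun.algebraMap_mem c⟩ =
        algebraMap ℚ symFun c := AlgHom.commutes _ c
    rw [h]
    exact isShiftification_algebraMap c
  | add f g hf hg h h' =>
    have hadd := map_add (symFunLift schurSeries) ⟨f, hf⟩ ⟨g, hg⟩
    exact congrArg Subtype.val hadd ▸ h.add h'
  | mul f g hf hg h h' =>
    have hmul := map_mul (symFunLift schurSeries) ⟨f, hf⟩ ⟨g, hg⟩
    exact congrArg Subtype.val hmul ▸ h.mul h'

theorem shiftedParkingSym_eq (n : ℕ) :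
    shiftedParkingSym n = (((n + 1 : ℕ) : ℚ)⁻¹ • coeff n (schurSeries ^ (n + 1)) : symFun) := by
  have hparking : parkingSym n =
      (((n + 1 : ℕ) : ℚ)⁻¹ • coeff n (complSeries ^ (n + 1)) : symFun) := by
    rw [parkingSym_eq, ← map_val_complSeries, ← map_pow, coeff_map]
    rfl
  rw [shiftedParkingSym, hparking, shiftification_eq_symFunLift, map_smul]
  congr 2
  have h := congrArg (coeff n)
    (congrArg (· ^ (n + 1)) map_symFunLift_schurSeries_complSeries)
  rwa [← map_pow, coeff_map] at h

end Schur

section ExpArcsinh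

open PowerSeries

/-- The central factorial `α (α + l - 2) (α + l - 4) ⋯ (α - l + 2)` with `l` factors, which is
`l!` times the coefficient of `u ^ l` in `(u + √(1 + u²)) ^ α`. -/
def centralFactorial (α : ℚ) : ℕ → ℚ
  | 0 => 1
  | l + 1 => α * ∏ j ∈ Finset.range l, (α + l - 1 - 2 * j)

theorem centralFactorial_add_two (α : ℚ) (l : ℕ) :
    centralFactorial α (l + 2) = (α ^ 2 - l ^ 2) * centralFactorial α l := by
  rcases l with _ | l
  · simp [centralFactorial]
    ring
  · simp only [centralFactorial, Finset.prod_range_succ, Finset.prod_range_succ' _ (l + 1)]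
    have hshift : ∀ j ∈ Finset.range l, α + ((l + 1 + 1 : ℕ) : ℚ) - 1 - 2 * ((j + 1 : ℕ) : ℚ) =
        α + (l : ℚ) - 1 - 2 * (j : ℚ) := fun j _ => by
      push_cast
      ring
    rw [Finset.prod_congr rfl hshift]
    push_cast
    ring

theorem centralFactorial_add_two_left (α : ℚ) (l : ℕ) :
    centralFactorial (α + 2) (l + 1) =
      centralFactorial α (l + 1) + 2 * (l + 1) * centralFactorial (α + 1) l := by
  rcases l with _ | l
  · simp [centralFactorial]
  · simp only [centralFactorial]
    rw [Finset.prod_range_succ', Finset.prod_range_succ]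
    have hshift : ∀ j ∈ Finset.range l, α + 2 + ((l + 1 : ℕ) : ℚ) - 1 - 2 * ((j + 1 : ℕ) : ℚ) =
        α + ((l + 1 : ℕ) : ℚ) - 1 - 2 * (j : ℚ) := fun j _ => by
      push_cast
      ring
    have hshift' : ∀ j ∈ Finset.range l, α + 1 + (l : ℚ) - 1 - 2 * (j : ℚ) =
        α + ((l + 1 : ℕ) : ℚ) - 1 - 2 * (j : ℚ) := fun j _ => by
      push_cast
      ring
    rw [Finset.prod_congr rfl hshift, Finset.prod_congr rfl hshift']
    push_cast
    ring

/-- The power series `√(1 + u²)`. -/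
noncomputable def sqrtOneAddSq : ℚ⟦X⟧ :=
  expand 2 two_ne_zero (PowerSeries.binomialSeries ℚ (1 / 2 : ℚ))

theorem sqrtOneAddSq_sq : sqrtOneAddSq ^ 2 = 1 + X ^ 2 := by
  have h : PowerSeries.binomialSeries ℚ (1 / 2 : ℚ) ^ 2 = 1 + X := by
    rw [sq, ← binomialSeries_add, add_halves]
    simpa using binomialSeries_nat (R := ℚ) (A := ℚ) 1
  rw [sqrtOneAddSq, ← map_pow, h, map_add, map_one, expand_X]

theorem choose_one_half (k : ℕ) :
    Ring.choose (1 / 2 : ℚ) k = centralFactorial 1 (2 * k) / (2 * k).factorial := by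
  induction k with
  | zero => simp [centralFactorial]
  | succ k ih =>
    have hrec : Ring.choose (1 / 2 : ℚ) (k + 1) =
        (1 / 2 - k) / (k + 1) * Ring.choose (1 / 2 : ℚ) k := by
      have := k.factorial_ne_zero
      simp only [Ring.choose_eq_smul, descPochhammer_succ_right, Polynomial.smeval_mul,
        Nat.factorial_succ]
      simp [Polynomial.smeval_sub, Polynomial.smeval_X, Polynomial.smeval_natCast]
      field_simp
    rw [hrec, ih, Nat.mul_succ, centralFactorial_add_two, Nat.factorial_succ, Nat.factorial_succ]
    have := (2 * k).factorial_ne_zero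
    push_cast
    field_simp
    ring

/-- The power series `u + √(1 + u²)`, which is `exp (arcsinh u)`. -/
noncomputable def expArcsinh : ℚ⟦X⟧ := X + sqrtOneAddSq

theorem expArcsinh_sq : expArcsinh ^ 2 = 1 + 2 * X * expArcsinh := by
  rw [expArcsinh]
  linear_combination sqrtOneAddSq_sq

theorem coeff_expArcsinh (l : ℕ) :
    coeff l expArcsinh = centralFactorial 1 l / l.factorial := by
  rw [expArcsinh, map_add, sqrtOneAddSq]
  obtain ⟨k, rfl | rfl⟩ := l.even_or_odd'
  · rw [coeff_expand_mul, binomialSeries_coeff, choose_one_half, coeff_X, if_neg (by omega)]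
    simp
  · rw [coeff_expand_of_not_dvd 2 _ _ (by omega), add_zero]
    rcases k with _ | k
    · simp [centralFactorial]
    · have hzero : centralFactorial 1 (2 * (k + 1) + 1) = 0 := by
        rw [centralFactorial, one_mul]
        refine Finset.prod_eq_zero (i := k + 1) (Finset.mem_range.2 (by omega)) ?_
        push_cast
        ring
      rw [hzero, coeff_X, if_neg (by omega), zero_div]

theorem coeff_expArcsinh_pow (m l : ℕ) :
    coeff l (expArcsinh ^ m) = centralFactorial m l / l.factorial := by
  induction m using Nat.twoStepInduction generalizing l with
  | zero => rcases l with _ | l <;> simp [centralFactorial, coeff_one]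
  | one => rw [pow_one, coeff_expArcsinh, Nat.cast_one]
  | more m ih ih' =>
    have hpow : expArcsinh ^ (m + 2) = expArcsinh ^ m + X * (2 * expArcsinh ^ (m + 1)) := by
      rw [pow_add, expArcsinh_sq]
      ring
    rcases l with _ | l
    · rw [hpow, map_add, coeff_zero_X_mul, add_zero, ih]
      simp [centralFactorial]
    · rw [hpow, map_add, coeff_succ_X_mul, two_mul, map_add, ih, ih']
      push_cast
      rw [centralFactorial_add_two_left, Nat.factorial_succ]
      have := l.factorial_ne_zero
      push_cast
      field_simp
      ring

variable {R : Type*} [CommRing R] [Algebra ℚ R] {U Q : R⟦X⟧}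

theorem expArcsinh_subst_sq (hU : constantCoeff U = 0) :
    expArcsinh.subst U ^ 2 = 1 + 2 * U * expArcsinh.subst U := by
  have hsubst : HasSubst U := HasSubst.of_constantCoeff_zero' hU
  have h := congrArg (substAlgHom hsubst) expArcsinh_sq
  rwa [map_pow, map_add, map_one, map_mul, map_mul, map_ofNat, substAlgHom_X,
    coe_substAlgHom] at h

theorem constantCoeff_subst_of_constantCoeff_zero (hU : constantCoeff U = 0) (F : ℚ⟦X⟧) :
    constantCoeff (F.subst U) = algebraMap ℚ R (constantCoeff F) := by
  rw [← coeff_zero_eq_constantCoeff_apply, coeff_subst' (HasSubst.of_constantCoeff_zero' hU),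
    finsum_eq_single _ 0 fun l hl => by simp [hU, hl], pow_zero, coeff_zero_one,
    Algebra.algebraMap_eq_smul_one, coeff_zero_eq_constantCoeff_apply]

theorem constantCoeff_expArcsinh_subst (hU : constantCoeff U = 0) :
    constantCoeff (expArcsinh.subst U) = 1 := by
  rw [constantCoeff_subst_of_constantCoeff_zero hU, ← coeff_zero_eq_constantCoeff_apply,
    coeff_expArcsinh]
  simp [centralFactorial]

theorem eq_expArcsinh_subst (hU : constantCoeff U = 0) (hQ : constantCoeff Q = 1)
    (hsq : Q ^ 2 = 1 + 2 * U * Q) : Q = expArcsinh.subst U := by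
  have hunit : IsUnit (Q + expArcsinh.subst U - 2 * U) := by
    rw [isUnit_iff_constantCoeff]
    simp only [map_sub, map_add, map_mul, hU, hQ, constantCoeff_expArcsinh_subst hU, mul_zero,
      sub_zero]
    have := (isUnit_iff_ne_zero.2 (two_ne_zero' ℚ)).map (algebraMap ℚ R)
    rwa [map_ofNat, ← one_add_one_eq_two] at this
  refine sub_eq_zero.1 (hunit.mul_left_eq_zero.1 ?_)
  linear_combination hsq - expArcsinh_subst_sq hU

end ExpArcsinh

section PartitionSum

open PowerSeries

theorem card_parts_le {n : ℕ} (lam : n.Partition) : lam.parts.card ≤ n := by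
  conv_rhs => rw [← lam.parts_sum]
  simpa using Multiset.card_nsmul_le_sum (s := lam.parts) (a := 1) fun _ hi => lam.parts_pos hi

variable {R : Type*} [CommRing R]

theorem prod_map_C_mul_X_pow (a : ℕ → R) (m : Multiset ℕ) :
    (m.map fun k => C (a k) * (X : R⟦X⟧) ^ k).prod = C (m.map a).prod * X ^ m.sum := by
  induction m using Multiset.induction_on with
  | empty => simp
  | cons k m ih =>
    simp only [Multiset.map_cons, Multiset.prod_cons, ih, Multiset.sum_cons, map_mul, pow_add]
    ring

theorem coeff_pow_eq_sum_sym {A : R⟦X⟧} {n : ℕ} {s : Finset ℕ}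
    (hs : ∀ k ≤ n, k ∉ s → coeff k A = 0) (l : ℕ) :
    coeff n (A ^ l) = ∑ m ∈ s.sym l with m.1.sum = n,
      (m.1.countPerms : R) * (m.1.map fun k => coeff k A).prod := by
  let T : R⟦X⟧ := ∑ k ∈ s, C (coeff k A) * X ^ k
  have hT : ∀ k, coeff k T = if k ∈ s then coeff k A else 0 := fun k => by
    simp only [T, map_sum, coeff_C_mul_X_pow, Finset.sum_ite_eq]
  have hdvd : X ^ (n + 1) ∣ A - T := X_pow_dvd_iff.2 fun k hk => by
    rw [map_sub, hT]
    split_ifs with hks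
    · exact sub_self _
    · rw [hs k (Nat.lt_succ_iff.1 hk) hks, sub_zero]
  have hpow : coeff n (A ^ l) = coeff n (T ^ l) := by
    have h := X_pow_dvd_iff.1 (hdvd.trans (sub_dvd_pow_sub_pow A T l)) n n.lt_succ_self
    rwa [map_sub, sub_eq_zero] at h
  have hterm : ∀ m : Multiset ℕ, coeff n ((m.countPerms : R⟦X⟧) *
      (C (m.map fun k => coeff k A).prod * X ^ m.sum)) =
      if m.sum = n then (m.countPerms : R) * (m.map fun k => coeff k A).prod else 0 := fun m => by
    rw [← map_natCast (C (R := R)), coeff_C_mul, coeff_C_mul_X_pow, mul_ite, mul_zero]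
    exact if_congr eq_comm rfl rfl
  rw [hpow, Finset.sum_pow, map_sum, Finset.sum_filter]
  simp only [prod_map_C_mul_X_pow, hterm]

theorem coeff_pow_eq_sum_partition {A : R⟦X⟧} (hA : constantCoeff A = 0) (n l : ℕ) :
    coeff n (A ^ l) = ∑ lam : n.Partition with lam.parts.card = l,
      (lam.parts.countPerms : R) * (lam.parts.map fun k => coeff k A).prod := by
  have hs : ∀ k ≤ n, k ∉ Finset.Icc 1 n → coeff k A = 0 := fun k hk hks => by
    obtain rfl : k = 0 := by
      rw [Finset.mem_Icc] at hks
      omega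
    rw [coeff_zero_eq_constantCoeff_apply, hA]
  have hmem : ∀ m : Sym ℕ l, m ∈ (Finset.Icc 1 n).sym l → ∀ k ∈ m.1, 0 < k := fun m hm k hk =>
    (Finset.mem_Icc.1 (Finset.mem_sym_iff.1 hm k hk)).1
  rw [coeff_pow_eq_sum_sym hs]
  symm
  refine Finset.sum_bij (fun lam h => (⟨lam.parts, (Finset.mem_filter.1 h).2⟩ : Sym ℕ l))
    ?_ ?_ ?_ fun _ _ => rfl
  · intro lam _
    refine Finset.mem_filter.2 ⟨Finset.mem_sym_iff.2 fun k hk => ?_, lam.parts_sum⟩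
    exact Finset.mem_Icc.2 ⟨lam.parts_pos hk, Nat.Partition.le_of_mem_parts hk⟩
  · intro lam _ mu _ h
    exact Nat.Partition.ext (congrArg Subtype.val h)
  · intro m h
    obtain ⟨hm, hsum⟩ := Finset.mem_filter.1 h
    exact ⟨⟨m.1, fun {k} hk => hmem m hm k hk, hsum⟩,
      Finset.mem_filter.2 ⟨Finset.mem_univ _, m.2⟩, rfl⟩

theorem coeff_subst_eq_sum_partition {S : Type*} [CommRing S] [Algebra S R] (F : S⟦X⟧) {A : R⟦X⟧}
    (hA : constantCoeff A = 0) (n : ℕ) :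
    coeff n (F.subst A) = ∑ lam : n.Partition, coeff lam.parts.card F •
      ((lam.parts.countPerms : R) * (lam.parts.map fun k => coeff k A).prod) := by
  have hsupport : (Function.support fun l => coeff l F • coeff n (A ^ l)) ⊆
      Finset.range (n + 1) := fun l hl => by
    by_contra h
    rw [Finset.coe_range, Set.mem_Iio, not_lt] at h
    have hpow : coeff n (A ^ l) = 0 :=
      X_pow_dvd_iff.1 (pow_dvd_pow_of_dvd (X_dvd_iff.2 hA) l) n h
    exact hl (show coeff l F • coeff n (A ^ l) = 0 by rw [hpow, smul_zero])
  rw [coeff_subst' (HasSubst.of_constantCoeff_zero' hA),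
    finsum_eq_sum_of_support_subset _ hsupport,
    ← Finset.sum_fiberwise_of_maps_to (g := fun lam : n.Partition => lam.parts.card)
      fun lam _ => Finset.mem_range_succ_iff.2 (card_parts_le lam)]
  refine Finset.sum_congr rfl fun l _ => ?_
  rw [coeff_pow_eq_sum_partition hA, Finset.smul_sum]
  refine Finset.sum_congr rfl fun lam hlam => ?_
  rw [(Finset.mem_filter.1 hlam).2]

end PartitionSum

section OddPart

open PowerSeries

/-- The part of odd degree of a power series. -/
noncomputable def oddPart {R : Type*} [CommRing R] (F : R⟦X⟧) : R⟦X⟧ :=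
  PowerSeries.mk fun n => if Odd n then coeff n F else 0

theorem coeff_oddPart {R : Type*} [CommRing R] (F : R⟦X⟧) (n : ℕ) :
    coeff n (oddPart F) = if Odd n then coeff n F else 0 :=
  coeff_mk _ _

theorem constantCoeff_oddPart {R : Type*} [CommRing R] (F : R⟦X⟧) :
    constantCoeff (oddPart F) = 0 := by
  rw [← coeff_zero_eq_constantCoeff_apply, coeff_oddPart, if_neg (by decide)]

theorem two_mul_oddPart {R : Type*} [CommRing R] (F : R⟦X⟧) :
    2 * oddPart F = F - rescale (-1) F := by
  ext n
  rw [two_mul, map_add, map_sub, coeff_rescale, coeff_oddPart]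
  rcases Nat.even_or_odd n with h | h
  · simp [Nat.not_odd_iff_even.2 h, h.neg_one_pow]
  · simp [h, h.neg_one_pow]

theorem prod_coeff_oddPart_eq_zero {R : Type*} [CommRing R] (F : R⟦X⟧) {n : ℕ}
    {lam : n.Partition} (hlam : lam ∉ Nat.Partition.odds n) :
    (lam.parts.map fun k => coeff k (oddPart F)).prod = 0 := by
  obtain ⟨k, hk, heven⟩ : ∃ k ∈ lam.parts, Even k := by
    simpa [Nat.Partition.odds, Nat.Partition.restricted] using hlam
  refine Multiset.prod_eq_zero (Multiset.mem_map.2 ⟨k, hk, ?_⟩)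
  rw [coeff_oddPart, if_neg (Nat.not_odd_iff_even.2 heven)]

variable {R : Type*} [CommRing R] [Algebra ℚ R] {Q : R⟦X⟧}

theorem eq_expArcsinh_subst_oddPart (hQ : constantCoeff Q = 1) (hinv : rescale (-1) Q * Q = 1) :
    Q = expArcsinh.subst (oddPart Q) :=
  eq_expArcsinh_subst (constantCoeff_oddPart Q) hQ (by
    linear_combination hinv - Q * two_mul_oddPart Q)

theorem coeff_pow_eq_sum_odds (hQ : constantCoeff Q = 1) (hinv : rescale (-1) Q * Q = 1)
    (n m : ℕ) :
    coeff n (Q ^ m) = ∑ lam ∈ Nat.Partition.odds n,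
      (centralFactorial m lam.parts.card / lam.parts.card.factorial : ℚ) •
        ((lam.parts.countPerms : R) * (lam.parts.map fun k => coeff k Q).prod) := by
  have hpow : Q ^ m = (expArcsinh ^ m).subst (oddPart Q) := by
    rw [subst_pow (HasSubst.of_constantCoeff_zero' (constantCoeff_oddPart Q)),
      ← eq_expArcsinh_subst_oddPart hQ hinv]
  rw [hpow, coeff_subst_eq_sum_partition _ (constantCoeff_oddPart Q),
    ← Finset.sum_subset (Finset.subset_univ (Nat.Partition.odds n)) fun lam _ hlam => by
      rw [prod_coeff_oddPart_eq_zero Q hlam, mul_zero, smul_zero]]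
  refine Finset.sum_congr rfl fun lam hlam => ?_
  have hodd : ∀ k ∈ lam.parts, coeff k (oddPart Q) = coeff k Q := fun k hk => by
    rw [coeff_oddPart, if_pos (Nat.not_even_iff_odd.1 ((Finset.mem_filter.1 hlam).2 k hk))]
  rw [coeff_expArcsinh_pow, Multiset.map_congr rfl hodd]

end OddPart

section Formula

open PowerSeries

theorem coe_prod_coeff_schurSeries (m : Multiset ℕ) :
    (((m.map fun k => coeff k schurSeries).prod : symFun) : MvPowerSeries ℕ ℚ) =
      (2 : ℚ) ^ m.card • (m.map schurP).prod := by
  have h := map_multiset_prod symFun.val (m.map fun k => coeff k schurSeries)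
  rw [Multiset.map_map] at h
  refine h.trans ?_
  have hcoeff : ∀ k ∈ m, (symFun.val ∘ fun k => coeff k schurSeries) k = (2 : ℚ) • schurP k :=
    fun k _ => coe_coeff_schurSeries_eq_smul_schurP k
  simp only [Multiset.map_congr rfl hcoeff, Algebra.smul_def, Multiset.prod_map_mul,
    Multiset.map_const', Multiset.prod_replicate, map_pow]

theorem shiftedCoeff_eq {n : ℕ} (lam : n.Partition) :
    shiftedCoeff lam = ((n + 1 : ℕ) : ℚ)⁻¹ *
      (centralFactorial (n + 1 : ℕ) lam.parts.card / lam.parts.card.factorial *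
        (lam.parts.countPerms * 2 ^ lam.parts.card)) := by
  have hcount : lam.parts.countPerms =
      Nat.multinomial lam.parts.toFinset fun i => lam.parts.count i := by
    rw [Multiset.countPerms, Finsupp.multinomial_eq, Multiset.toFinsupp_support]
    rfl
  rw [shiftedCoeff, hcount]
  rcases hcard : lam.parts.card with _ | l
  · have hn : n = 0 := by rw [← lam.parts_sum, Multiset.card_eq_zero.1 hcard, Multiset.sum_zero]
    simp [hn, centralFactorial]
  · have hprod : ∀ j ∈ Finset.range l, (n : ℚ) + ((l + 1 : ℕ) : ℚ) - 1 - 2 * j =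
        ((n + 1 : ℕ) : ℚ) + l - 1 - 2 * j := fun j _ => by
      push_cast
      ring
    rw [centralFactorial, Nat.add_sub_cancel, Finset.prod_congr rfl hprod]
    have : ((n + 1 : ℕ) : ℚ) ≠ 0 := by positivity
    field_simp

theorem shiftedParkingSym_eq_sum_odds (n : ℕ) :
    shiftedParkingSym n = ∑ lam ∈ Nat.Partition.odds n, shiftedCoeff lam • prodP lam := by
  rw [shiftedParkingSym_eq,
    coeff_pow_eq_sum_odds constantCoeff_schurSeries rescale_schurSeries_mul_schurSeries,
    Finset.smul_sum, AddSubmonoidClass.coe_finsetSum]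
  refine Finset.sum_congr rfl fun lam _ => ?_
  simp only [SetLike.val_smul, MulMemClass.coe_mul, coe_prod_coeff_schurSeries]
  rw [SubringClass.coe_natCast, ← nsmul_eq_mul, ← Nat.cast_smul_eq_nsmul ℚ, smul_smul, smul_smul,
    smul_smul, shiftedCoeff_eq, prodP, mul_assoc, mul_assoc]

theorem shiftedCoeff_nonneg {n : ℕ} (lam : n.Partition) : 0 ≤ shiftedCoeff lam := by
  rw [shiftedCoeff]
  refine mul_nonneg (by positivity) (Finset.prod_nonneg fun j hj => ?_)
  have hj' : ((j + 2 : ℕ) : ℚ) ≤ lam.parts.card :=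
    Nat.cast_le.2 (Nat.lt_sub_iff_add_lt.1 (Finset.mem_range.1 hj))
  have hcard : (lam.parts.card : ℚ) ≤ n := Nat.cast_le.2 (card_parts_le lam)
  push_cast at hj'
  linarith

end Formula

section Independence

open PowerSeries

theorem rescale_oddPart {R : Type*} [CommRing R] (F : R⟦X⟧) :
    rescale (-1) (oddPart F) = -oddPart F := by
  ext n
  rw [coeff_rescale, map_neg, coeff_oddPart]
  split_ifs with h
  · rw [h.neg_one_pow, neg_one_mul]
  · rw [mul_zero, neg_zero]

variable {R : Type*} [CommRing R] [Algebra ℚ R]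

theorem rescale_expArcsinh_subst_oddPart (A : R⟦X⟧) :
    rescale (-1) (expArcsinh.subst (oddPart A)) =
      expArcsinh.subst (oddPart A) - 2 * oddPart A := by
  have hU := constantCoeff_oddPart A
  have hsq := expArcsinh_subst_sq hU
  have hone := constantCoeff_expArcsinh_subst hU
  have hneg : constantCoeff (-oddPart A) = 0 := by rw [map_neg, hU, neg_zero]
  have hsq_neg := congrArg (rescale (-1)) hsq
  simp only [map_pow, map_add, map_mul, map_one, map_ofNat, rescale_oddPart] at hsq_neg
  refine (eq_expArcsinh_subst hneg ?_ hsq_neg).trans (eq_expArcsinh_subst hneg ?_ ?_).symm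
  · rw [← coeff_zero_eq_constantCoeff_apply, coeff_rescale, pow_zero, one_mul,
      coeff_zero_eq_constantCoeff_apply, hone]
  · rw [map_sub, map_mul, hU, hone, mul_zero, sub_zero]
  · linear_combination hsq

theorem oddPart_expArcsinh_subst_oddPart (A : R⟦X⟧) :
    oddPart (expArcsinh.subst (oddPart A)) = oddPart A := by
  have htwo : IsUnit (2 : R⟦X⟧) := by
    rw [← map_ofNat (algebraMap ℚ R⟦X⟧) 2]
    exact (isUnit_iff_ne_zero.2 (two_ne_zero' ℚ)).map _
  refine htwo.mul_left_cancel ?_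
  rw [two_mul_oddPart, rescale_expArcsinh_subst_oddPart, sub_sub_cancel]

-- `E = (1 + Q) / 2` solves `E(t) / E(-t) = Q(t)`, because `Q(-t) = 1 / Q(t)`.
theorem exists_map_schurSeries_eq_expArcsinh_subst (A : R⟦X⟧) : ∃ φ : symFun →ₐ[ℚ] R,
    PowerSeries.map φ.toRingHom schurSeries = expArcsinh.subst (oddPart A) := by
  have hU := constantCoeff_oddPart A
  have hsq := expArcsinh_subst_sq hU
  have hone := constantCoeff_expArcsinh_subst hU
  have hneg := rescale_expArcsinh_subst_oddPart A
  set Q : R⟦X⟧ := expArcsinh.subst (oddPart A)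
  let half : R⟦X⟧ := algebraMap ℚ R⟦X⟧ (1 / 2)
  let F : R⟦X⟧ := half * (1 + Q)
  have hF : constantCoeff F = 1 := by
    rw [map_mul, map_add, map_one, hone, RingHom.map_rat_algebraMap, ← map_one (algebraMap ℚ R),
      ← map_add, ← map_mul]
    norm_num
  have hrescale : rescale (-1) F = half * (1 + rescale (-1) Q) := by
    rw [map_mul, map_add, map_one, RingHom.map_rat_algebraMap]
  have hquot : rescale (-1) F * Q = F := by
    rw [hrescale, hneg]
    linear_combination half * hsq
  refine ⟨symFunLift F, ?_⟩
  rw [schurSeries, map_mul, map_symFunLift_elemSeries hF]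
  linear_combination Q * rescale_mul_map_symFunLift_complSeries hF -
    PowerSeries.map (symFunLift F).toRingHom complSeries * hquot

theorem exists_algHom_coeff_schurSeries_odd (a : ℕ → R) : ∃ φ : symFun →ₐ[ℚ] R,
    ∀ i, φ (coeff (2 * i + 1) schurSeries) = a i := by
  let A : R⟦X⟧ := PowerSeries.mk fun n => a (n / 2)
  obtain ⟨φ, hφ⟩ := exists_map_schurSeries_eq_expArcsinh_subst A
  refine ⟨φ, fun i => ?_⟩
  have hodd : Odd (2 * i + 1) := odd_two_mul_add_one i
  have h := congrArg (coeff (2 * i + 1)) (congrArg oddPart hφ)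
  rw [oddPart_expArcsinh_subst_oddPart, coeff_oddPart, coeff_oddPart, if_pos hodd, if_pos hodd,
    coeff_map, coeff_mk] at h
  exact h.trans (congrArg a (by omega))

theorem algebraicIndependent_schurP_odd :
    AlgebraicIndependent ℚ fun i : ℕ => schurP (2 * i + 1) := by
  obtain ⟨φ, hφ⟩ := exists_algHom_coeff_schurSeries_odd fun i =>
    (2 : ℚ) • (MvPolynomial.X i : MvPolynomial ℕ ℚ)
  let P : ℕ → symFun := fun i => (2⁻¹ : ℚ) • coeff (2 * i + 1) schurSeries
  have hP : symFun.val ∘ P = fun i => schurP (2 * i + 1) := funext fun i => by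
    simp only [P, Function.comp_apply, Subalgebra.coe_val, SetLike.val_smul,
      coe_coeff_schurSeries_eq_smul_schurP, inv_smul_smul₀ (two_ne_zero' ℚ)]
  have hφP : φ ∘ P = MvPolynomial.X := funext fun i => by
    simp only [P, Function.comp_apply, map_smul, hφ, inv_smul_smul₀ (two_ne_zero' ℚ)]
  have hind : AlgebraicIndependent ℚ P :=
    AlgebraicIndependent.of_comp φ (hφP ▸ MvPolynomial.algebraicIndependent_X ℕ ℚ)
  exact hP ▸ hind.map' (f := symFun.val) Subtype.val_injective

end Independence

end ShiftedParking

theorem theorem3 :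
    AlgebraicIndependent ℚ (fun i : ℕ => ShiftedParking.schurP (2 * i + 1)) ∧
    ∀ n : ℕ,
      ShiftedParking.shiftedParkingSym n =
        ∑ lam ∈ Nat.Partition.odds n,
          ShiftedParking.shiftedCoeff lam • ShiftedParking.prodP lam ∧
      ∀ lam ∈ Nat.Partition.odds n, 0 ≤ ShiftedParking.shiftedCoeff lam := by
  exact ⟨ShiftedParking.algebraicIndependent_schurP_odd, fun n =>
    ⟨ShiftedParking.shiftedParkingSym_eq_sum_odds n,
      fun lam _ => ShiftedParking.shiftedCoeff_nonneg lam⟩⟩
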